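/- Let $k$ be a field, $a\ge 3$ an integer, $q\in k$ a primitive $a$-th root of unity, and $$A=k\langle X,Y\rangle/(X^a,\;XY-qYX,\;Y^a),$$ with $x,y$ the residue classes of $X,Y$. Let $A^e=A\otimes_k A^{\mathrm{op}}$ and let $HH^{2*}(A)=\bigoplus_{t\ge 0}\mathrm{Ext}^{2t}_{A^e}(A,A)$ be the even part of the Hochschild cohomology ring, with the Yoneda product. For $n\ge 0$ let $P_n$ be the free left $A^e$-module with basis $f^n_0,\dots,f^n_n$, put $f^n_{-1}=f^n_{n+1}=0$, and for $s\ge 0$ put $\tau_x(s)=q^s(1\otimes x)-x\otimes 1$, $\tau_y(s)=1\otimes y-q^s(y\otimes 1)$, $\gamma_x(s)=\sum_{j=0}^{a-1}q^{js}\,x^{a-1-j}\otimes x^j$, $\gamma_y(s)=\sum_{j=0}^{a-1}q^{js}\,y^j\otimes y^{a-1-j}$. Let $d_n:P_n\to P_{n-1}$ be given by $$d_{2t}(f^{2t}_i)=\begin{cases}\gamma_y(0)f^{2t-1}_i+\gamma_x(0)f^{2t-1}_{i-1}& i\text{ even}\\ -\tau_y(1)f^{2t-1}_i+\tau_x(1)f^{2t-1}_{i-1}&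 i\text{ odd,}\end{cases}\qquad d_{2t+1}(f^{2t+1}_i)=\begin{cases}\tau_y(0)f^{2t}_i+\gamma_x(1)f^{2t}_{i-1}& i\text{ even}\\ -\gamma_y(1)f^{2t}_i+\tau_x(0)f^{2t}_{i-1}& i\text{ odd,}\end{cases}$$ and let $\mu:P_0\to A$ be given by $f^0_0\mapsto 1$. Then $(P_\bullet,d)$ with augmentation $\mu$ is a projective resolution of $A$ over $A^e$. For $0\le j\le 2t$ let $\zeta^{2t}_j\in HH^{2t}(A)$ be the class of the map $P_{2t}\to A$, $f^{2t}_i\mapsto\delta_{ij}$; for $j$ even let $\eta^+_j\in HH^{2t}(A)$ be the class of $f^{2t}_i\mapsto\delta_{ij}\,x^{a-1}y^{a-1}$, and for $j$ odd let $\eta^-_j\in HH^{2t}(A)$ be the class of $f^{2t}_i\mapsto\delta_{ij}\,xy$ (all these maps are cocycles). Let $R_0$ and $R_1$ be the $k$-linear spans of all $\zeta^{2t}_i$ ($t\ge 0$, $0\le i\le 2t$) with $i$ even, respectively $i$ odd. Then: 1. $R_0$ is a $k$-subalgebra of $HH^{2*}(A)$, and there is an isomorphism of $k$-algebras $k[z_0,z_1]\cong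 R_0$ with $z_0\mapsto\zeta^2_0$, $z_1\mapsto\zeta^2_2$; thus $R_0$ is a polynomial ring in two variables generated in degree $2$. 2. $HH^{2*}(A)$ has a largest homogeneous nilpotent ideal $\mathcal N$. 3. All classes $\eta^+_j$, $\eta^-_j$ (in all degrees $2t$) and all elements of $R_1$ are nilpotent and lie in $\mathcal N$, while $R_0\cap\mathcal N=0$. 4. The composite $R_0\hookrightarrow HH^{2*}(A)\to HH^{2*}(A)/\mathcal N$ is an isomorphism of $k$-algebras; in particular $HH^{2*}(A)/\mathcal N\cong R_0$. -/

import Mathlib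

open CategoryTheory TensorProduct DirectSum

universe u

noncomputable section

namespace HH

/-! ### The even Hochschild cohomology ring of an algebra over a field -/

section General

variable (k : Type u) [Field k] (A : Type u) [Ring A] [Algebra k A]

/-- The enveloping algebra `Aᵉ = A ⊗ Aᵒᵖ`. -/
def Env : Type u := A ⊗[k] Aᵐᵒᵖ

instance : Ring (Env k A) := inferInstanceAs (Ring (A ⊗[k] Aᵐᵒᵖ))

instance : Algebra k (Env k A) := inferInstanceAs (Algebra k (A ⊗[k] Aᵐᵒᵖ))

variable {A} in
/-- The element `u ⊗ v` of the enveloping algebra. -/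
def tens (u v : A) : Env k A := (u ⊗ₜ[k] MulOpposite.op v : A ⊗[k] Aᵐᵒᵖ)

/-- `A` as a left `Aᵉ`-module: `(u ⊗ v) • m = u * m * v`. -/
instance : Module (Env k A) A := instModuleTensorProductMop k A

section

variable {A}

theorem tens_smul (u v m : A) : tens k u v • m = u * m * v := by
  refine (TensorProduct.Algebra.moduleAux_apply u (MulOpposite.op v) m).trans ?_
  rw [MulOpposite.smul_eq_mul_unop, smul_eq_mul, ← mul_assoc, MulOpposite.unop_op]

theorem tens_mul (u v u' v' : A) : tens k u v * tens k u' v' = tens k (u * u') (v' * v) :=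
  Algebra.TensorProduct.tmul_mul_tmul _ _ _ _

theorem one_eq_tens : (1 : Env k A) = tens k 1 1 := rfl

theorem smul_tens (r : k) (u v : A) : r • tens k u v = tens k (r • u) v := rfl

theorem tens_smul_right (r : k) (u v : A) : tens k u (r • v) = r • tens k u v :=
  TensorProduct.tmul_smul r u (MulOpposite.op v)

theorem zero_tens (v : A) : tens k 0 v = 0 := TensorProduct.zero_tmul _ _

theorem tens_zero (u : A) : tens k u 0 = 0 := TensorProduct.tmul_zero _ _

theorem env_induction {C : Env k A → Prop} (e : Env k A) (h0 : C 0)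
    (ht : ∀ u v, C (tens k u v)) (ha : ∀ e f, C e → C f → C (e + f)) : C e :=
  TensorProduct.induction_on (motive := C) e h0 (fun u v => ht u v.unop) ha

end

instance : IsScalarTower k (Env k A) A where
  smul_assoc r e m := by
    refine env_induction k (C := fun e => (r • e) • m = r • e • m) e ?_ ?_ ?_
    · rw [smul_zero, zero_smul, smul_zero]
    · intro u v
      rw [smul_tens, tens_smul, tens_smul, smul_mul_assoc, smul_mul_assoc]
    · intro e f he hf
      rw [smul_add, add_smul, he, hf, add_smul, smul_add]

/-- The bimodule `A`, as an object of the category of left `Aᵉ`-modules. -/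
abbrev bimod : ModuleCat.{u} (Env k A) := ModuleCat.of (Env k A) A

/-- The Hochschild cohomology group `HH^n(A) = Ext^n_{Aᵉ}(A, A)`. -/
abbrev Coh (n : ℕ) : Type u := Abelian.Ext.{u} (bimod k A) (bimod k A) n

/-- The component of index `n` of the even Hochschild cohomology: `HH^{2n}(A)`. -/
abbrev EvenCoh (n : ℕ) : Type u := Coh k A (2 * n)

variable {k A} in
theorem mk_comp_congr {i j : ℕ} (x : Coh k A i) (y : Coh k A j) (m n : ℕ)
    (hm : i + j = 2 * m) (hn : i + j = 2 * n) :
    (⟨m, x.comp y hm⟩ : GradedMonoid (EvenCoh k A)) = ⟨n, x.comp y hn⟩ := by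
  obtain rfl : m = n := by omega
  rfl

/-- The Yoneda product of even classes. -/
instance evenGMul : GradedMonoid.GMul (EvenCoh k A) where
  mul {i j} x y := x.comp y (by omega)

/-- The unit is the class of the identity of `A`. -/
instance evenGOne : GradedMonoid.GOne (EvenCoh k A) where
  one := Abelian.Ext.mk₀ (𝟙 (bimod k A))

instance evenGMonoid : GradedMonoid.GMonoid (EvenCoh k A) where
  one_mul := by
    rintro ⟨i, x⟩
    refine (mk_comp_congr (Abelian.Ext.mk₀ (𝟙 (bimod k A))) x (0 + i) i (by omega)
      (by omega)).trans ?_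
    rw [Abelian.Ext.mk₀_id_comp]
  mul_one := by
    rintro ⟨i, x⟩
    refine (mk_comp_congr x (Abelian.Ext.mk₀ (𝟙 (bimod k A))) (i + 0) i (by omega)
      (by omega)).trans ?_
    rw [Abelian.Ext.comp_mk₀_id]
  mul_assoc := by
    rintro ⟨i, x⟩ ⟨j, y⟩ ⟨l, z⟩
    refine Eq.trans ?_ (mk_comp_congr x
      (Abelian.Ext.comp y z (show 2 * j + 2 * l = 2 * (j + l) by omega))
      (i + j + l) (i + (j + l)) (by omega) (by omega))
    exact congrArg (fun w => (⟨i + j + l, w⟩ : GradedMonoid (EvenCoh k A)))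
      (Abelian.Ext.comp_assoc x y z (show 2 * i + 2 * j = 2 * (i + j) by omega)
        (show 2 * j + 2 * l = 2 * (j + l) by omega)
        (show 2 * i + 2 * j + 2 * l = 2 * (i + j + l) by omega))

instance evenGRing : DirectSum.GRing (EvenCoh k A) where
  mul_zero _ := Abelian.Ext.comp_zero _ _ _ _ _
  zero_mul _ := Abelian.Ext.zero_comp _ _ _ _ _
  mul_add _ _ _ := Abelian.Ext.comp_add _ _ _ _
  add_mul _ _ _ := Abelian.Ext.add_comp _ _ _ _
  natCast n := n • (Abelian.Ext.mk₀ (𝟙 (bimod k A)) : EvenCoh k A 0)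
  natCast_zero := zero_smul _ _
  natCast_succ _ := succ_nsmul _ _
  intCast n := n • (Abelian.Ext.mk₀ (𝟙 (bimod k A)) : EvenCoh k A 0)
  intCast_ofNat _ := natCast_zsmul _ _
  intCast_negSucc_ofNat _ := negSucc_zsmul _ _

instance evenGAlgebra : DirectSum.GAlgebra k (EvenCoh k A) where
  toFun :=
    { toFun := fun r => r • (Abelian.Ext.mk₀ (𝟙 (bimod k A)) : EvenCoh k A 0)
      map_zero' := zero_smul _ _
      map_add' := fun r s => add_smul _ _ _ }
  map_one := by
    change (1 : k) • (Abelian.Ext.mk₀ (𝟙 (bimod k A)) : EvenCoh k A 0) = _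
    rw [one_smul]
    rfl
  map_mul r s := by
    refine Eq.trans ?_ (mk_comp_congr
      (r • (Abelian.Ext.mk₀ (𝟙 (bimod k A)) : EvenCoh k A 0))
      (s • (Abelian.Ext.mk₀ (𝟙 (bimod k A)) : EvenCoh k A 0)) 0 (0 + 0) (by omega) (by omega))
    refine congrArg (fun w => (⟨0, w⟩ : GradedMonoid (EvenCoh k A))) ?_
    rw [Abelian.Ext.smul_comp, Abelian.Ext.comp_smul, ← mul_smul]
    exact congrArg (fun w : EvenCoh k A 0 => (r * s) • w) (Abelian.Ext.mk₀_id_comp _).symm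
  commutes r := by
    rintro ⟨i, x⟩
    refine (mk_comp_congr (r • (Abelian.Ext.mk₀ (𝟙 (bimod k A)) : EvenCoh k A 0)) x (0 + i) i
      (by omega) (by omega)).trans (Eq.trans ?_ (mk_comp_congr x
      (r • (Abelian.Ext.mk₀ (𝟙 (bimod k A)) : EvenCoh k A 0)) i (i + 0) (by omega) (by omega)))
    refine congrArg (fun w => (⟨i, w⟩ : GradedMonoid (EvenCoh k A))) ?_
    rw [Abelian.Ext.smul_comp, Abelian.Ext.comp_smul]
    exact congrArg (r • ·)
      ((Abelian.Ext.mk₀_id_comp _).trans (Abelian.Ext.comp_mk₀_id _).symm)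
  smul_def r := by
    rintro ⟨i, x⟩
    refine Eq.trans ?_ (mk_comp_congr
      (r • (Abelian.Ext.mk₀ (𝟙 (bimod k A)) : EvenCoh k A 0)) x i (0 + i) (by omega) (by omega))
    refine congrArg (fun w => (⟨i, w⟩ : GradedMonoid (EvenCoh k A))) ?_
    rw [Abelian.Ext.smul_comp]
    exact congrArg (r • ·) (Abelian.Ext.mk₀_id_comp _).symm

/-- The even Hochschild cohomology ring `HH^{2*}(A) = ⨁ n, HH^{2n}(A)`, a `k`-algebra under the
Yoneda product. -/
abbrev EvenRing : Type u := ⨁ n : ℕ, EvenCoh k A n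

variable {k A} in
/-- An ideal of `HH^{2*}(A)` is homogeneous if it contains the homogeneous components of each of
its elements. -/
def IsHomogeneousIdeal (I : Ideal (EvenRing k A)) : Prop :=
  ∀ z ∈ I, ∀ n : ℕ, DirectSum.of (EvenCoh k A) n (z n) ∈ I

end General

/-! ### The quantum complete intersection and its bimodule resolution -/

section QCI

variable (k : Type u) [Field k] (a : ℕ) (q : k)

/-- The relations `X^a = 0`, `XY = q YX`, `Y^a = 0`, where `X`, `Y` are the two free generators. -/
inductive QCIRel : FreeAlgebra k (Fin 2) → FreeAlgebra k (Fin 2) → Prop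
  | powX : QCIRel (FreeAlgebra.ι k 0 ^ a) 0
  | comm : QCIRel (FreeAlgebra.ι k 0 * FreeAlgebra.ι k 1)
      (q • (FreeAlgebra.ι k 1 * FreeAlgebra.ι k 0))
  | powY : QCIRel (FreeAlgebra.ι k 1 ^ a) 0

/-- The quantum complete intersection `k⟨X, Y⟩ / (X^a, XY - q YX, Y^a)`. -/
def QCI : Type u := RingQuot (QCIRel k a q)

instance : Ring (QCI k a q) := inferInstanceAs (Ring (RingQuot (QCIRel k a q)))

instance : Algebra k (QCI k a q) := inferInstanceAs (Algebra k (RingQuot (QCIRel k a q)))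

/-- The residue class of `X`. -/
def x : QCI k a q := RingQuot.mkAlgHom k (QCIRel k a q) (FreeAlgebra.ι k 0)

/-- The residue class of `Y`. -/
def y : QCI k a q := RingQuot.mkAlgHom k (QCIRel k a q) (FreeAlgebra.ι k 1)

theorem x_pow : x k a q ^ a = 0 := by
  have h := RingQuot.mkAlgHom_rel k (QCIRel.powX (k := k) (a := a) (q := q))
  rw [map_pow, map_zero] at h
  exact h

theorem y_pow : y k a q ^ a = 0 := by
  have h := RingQuot.mkAlgHom_rel k (QCIRel.powY (k := k) (a := a) (q := q))
  rw [map_pow, map_zero] at h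
  exact h

theorem x_mul_y : x k a q * y k a q = q • (y k a q * x k a q) := by
  have h := RingQuot.mkAlgHom_rel k (QCIRel.comm (k := k) (a := a) (q := q))
  rw [map_mul, map_smul, map_mul] at h
  exact h

/-- The enveloping algebra of the quantum complete intersection. -/
abbrev E : Type u := Env k (QCI k a q)

/-- The element `x^i ⊗ x^j` of the enveloping algebra. -/
def xx (i j : ℕ) : E k a q := tens k (x k a q ^ i) (x k a q ^ j)

/-- The element `y^i ⊗ y^j` of the enveloping algebra. -/
def yy (i j : ℕ) : E k a q := tens k (y k a q ^ i) (y k a q ^ j)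

/-- `τ_x(s) = q^s (1 ⊗ x) - x ⊗ 1`. -/
def tauX (s : ℕ) : E k a q := q ^ s • xx k a q 0 1 - xx k a q 1 0

/-- `τ_y(s) = 1 ⊗ y - q^s (y ⊗ 1)`. -/
def tauY (s : ℕ) : E k a q := yy k a q 0 1 - q ^ s • yy k a q 1 0

/-- `γ_x(s) = ∑_{j < a} q^{js} (x^{a-1-j} ⊗ x^j)`. -/
def gammaX (s : ℕ) : E k a q := ∑ j ∈ Finset.range a, q ^ (j * s) • xx k a q (a - 1 - j) j

/-- `γ_y(s) = ∑_{j < a} q^{js} (y^j ⊗ y^{a-1-j})`. -/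
def gammaY (s : ℕ) : E k a q := ∑ j ∈ Finset.range a, q ^ (j * s) • yy k a q j (a - 1 - j)

/-- The free `Aᵉ`-module `P_n` of rank `n + 1`. -/
abbrev P (n : ℕ) : Type u := Fin (n + 1) →₀ E k a q

/-- The free generator `f^n_i` of `P_n` for `0 ≤ i ≤ n`; by convention `f^n_i = 0` otherwise. -/
def gen (n : ℕ) (i : ℤ) : P k a q n :=
  if h : 0 ≤ i ∧ i < n + 1 then Finsupp.single ⟨i.toNat, by omega⟩ 1 else 0

/-- The value `d_{n+1}(f^{n+1}_i)` of the differential on a generator. -/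
def dgen (n : ℕ) (i : ℤ) : P k a q n :=
  if Even (n + 1) then
    if Even i then gammaY k a q 0 • gen k a q n i + gammaX k a q 0 • gen k a q n (i - 1)
    else -tauY k a q 1 • gen k a q n i + tauX k a q 1 • gen k a q n (i - 1)
  else
    if Even i then tauY k a q 0 • gen k a q n i + gammaX k a q 1 • gen k a q n (i - 1)
    else -gammaY k a q 1 • gen k a q n i + tauX k a q 0 • gen k a q n (i - 1)

/-- The differential `d_{n+1} : P_{n+1} → P_n`. -/
def d (n : ℕ) : P k a q (n + 1) →ₗ[E k a q] P k a q n :=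
  Finsupp.linearCombination (E k a q) fun i : Fin (n + 2) => dgen k a q n (i : ℕ)

/-- The map of `Aᵉ`-modules `P_n → A` with `f^n_i ↦ p i`. -/
def cochain (n : ℕ) (p : ℕ → QCI k a q) : P k a q n →ₗ[E k a q] QCI k a q :=
  Finsupp.linearCombination (E k a q) fun i : Fin (n + 1) => p i

theorem d_gen (n : ℕ) (i : ℤ) : d k a q n (gen k a q (n + 1) i) = dgen k a q n i := by
  by_cases h : 0 ≤ i ∧ i < (n + 1 : ℕ) + 1
  · rw [gen, dif_pos h, d, Finsupp.linearCombination_single, one_smul]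
    congr 1
    simp only
    omega
  · have h1 : gen k a q n i = 0 := by rw [gen, dif_neg]; omega
    have h2 : gen k a q n (i - 1) = 0 := by rw [gen, dif_neg]; omega
    rw [gen, dif_neg h, dgen, h1, h2]
    simp

theorem cochain_gen (n : ℕ) (p : ℕ → QCI k a q) (i : ℤ) :
    cochain k a q n p (gen k a q n i) = if 0 ≤ i ∧ i < n + 1 then p i.toNat else 0 := by
  by_cases h : 0 ≤ i ∧ i < n + 1
  · rw [gen, dif_pos h, if_pos h, cochain, Finsupp.linearCombination_single, one_smul]
  · rw [gen, dif_neg h, if_neg h, map_zero]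

theorem d_single (n : ℕ) (i : Fin (n + 2)) :
    d k a q n (Finsupp.single i 1) = dgen k a q n (i : ℕ) := by
  rw [d, Finsupp.linearCombination_single, one_smul]

/-! Relations in the enveloping algebra. -/

theorem xx_mul (i j m n : ℕ) : xx k a q i j * xx k a q m n = xx k a q (i + m) (j + n) := by
  rw [xx, xx, xx, tens_mul, ← pow_add, ← pow_add, add_comm n]

theorem yy_mul (i j m n : ℕ) : yy k a q i j * yy k a q m n = yy k a q (i + m) (j + n) := by
  rw [yy, yy, yy, tens_mul, ← pow_add, ← pow_add, add_comm n]

theorem xx_left (j : ℕ) : xx k a q a j = 0 := by rw [xx, x_pow, zero_tens]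

theorem xx_right (i : ℕ) : xx k a q i a = 0 := by
  rw [xx, x_pow, tens_zero]

theorem yy_left (j : ℕ) : yy k a q a j = 0 := by rw [yy, y_pow, zero_tens]

theorem yy_right (i : ℕ) : yy k a q i a = 0 := by
  rw [yy, y_pow, tens_zero]

theorem x_mul_y_pow (n : ℕ) : x k a q * y k a q ^ n = q ^ n • (y k a q ^ n * x k a q) := by
  induction n with
  | zero => simp
  | succ n ih =>
    rw [pow_succ, ← mul_assoc, ih, smul_mul_assoc, mul_assoc, x_mul_y, mul_smul_comm, smul_smul,
      ← pow_succ, mul_assoc]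

theorem x_pow_mul_y_pow (m n : ℕ) :
    x k a q ^ m * y k a q ^ n = q ^ (m * n) • (y k a q ^ n * x k a q ^ m) := by
  induction m with
  | zero => simp
  | succ m ih =>
    rw [pow_succ, mul_assoc, x_mul_y_pow, mul_smul_comm, ← mul_assoc, ih, smul_mul_assoc,
      smul_smul, mul_assoc, ← pow_add]
    congr 2
    ring

/-- Commutation of the `x`-part and the `y`-part, up to powers of `q` on both sides. -/
theorem xx_mul_yy (i j m n : ℕ) :
    q ^ (j * n) • (xx k a q i j * yy k a q m n) = q ^ (i * m) • (yy k a q m n * xx k a q i j) := by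
  rw [xx, yy, tens_mul, tens_mul, x_pow_mul_y_pow, x_pow_mul_y_pow, tens_smul_right, ← smul_tens,
    smul_comm]

theorem telescope {M : Type u} [AddCommGroup M] (F : ℕ → M) (h0 : F 0 = 0) (ha : F a = 0) :
    ∑ j ∈ Finset.range a, (F (j + 1) - F j) = 0 := by
  rw [Finset.sum_range_sub, h0, ha, sub_zero]

variable {k a q}

theorem gammaX_mul_tauX (s : ℕ) : gammaX k a q s * tauX k a q s = 0 := by
  rw [gammaX, tauX, Finset.sum_mul,
    ← telescope a (fun j => q ^ (j * s) • xx k a q (a - j) j) (by simp [xx_left])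
      (by simp [xx_right])]
  refine Finset.sum_congr rfl fun j hj => ?_
  have hj := Finset.mem_range.1 hj
  rw [mul_sub, smul_mul_assoc, smul_mul_assoc, mul_smul_comm, xx_mul, xx_mul, smul_smul,
    ← pow_add]
  congr 3
  · ring
  · omega
  · omega

theorem tauX_mul_gammaX (s : ℕ) : tauX k a q s * gammaX k a q s = 0 := by
  rw [gammaX, tauX, Finset.mul_sum,
    ← telescope a (fun j => q ^ (j * s) • xx k a q (a - j) j) (by simp [xx_left])
      (by simp [xx_right])]
  refine Finset.sum_congr rfl fun j hj => ?_
  have hj := Finset.mem_range.1 hj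
  rw [sub_mul, mul_smul_comm, mul_smul_comm, smul_mul_assoc, xx_mul, xx_mul, smul_smul,
    ← pow_add]
  congr 3
  · ring
  · omega
  · omega
  · omega
  · omega

theorem gammaY_mul_tauY (s : ℕ) : gammaY k a q s * tauY k a q s = 0 := by
  rw [gammaY, tauY, Finset.sum_mul, ← neg_eq_zero, ← Finset.sum_neg_distrib,
    ← telescope a (fun j => q ^ (j * s) • yy k a q j (a - j)) (by simp [yy_right])
      (by simp [yy_left])]
  refine Finset.sum_congr rfl fun j hj => ?_
  have hj := Finset.mem_range.1 hj
  rw [mul_sub, smul_mul_assoc, smul_mul_assoc, mul_smul_comm, yy_mul, yy_mul, smul_smul,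
    ← pow_add, neg_sub]
  congr 3
  · ring
  · omega
  · omega

theorem tauY_mul_gammaY (s : ℕ) : tauY k a q s * gammaY k a q s = 0 := by
  rw [gammaY, tauY, Finset.mul_sum, ← neg_eq_zero, ← Finset.sum_neg_distrib,
    ← telescope a (fun j => q ^ (j * s) • yy k a q j (a - j)) (by simp [yy_right])
      (by simp [yy_left])]
  refine Finset.sum_congr rfl fun j hj => ?_
  have hj := Finset.mem_range.1 hj
  rw [sub_mul, mul_smul_comm, mul_smul_comm, smul_mul_assoc, yy_mul, yy_mul, smul_smul,
    ← pow_add, neg_sub]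
  congr 3
  · ring
  · omega
  · omega
  · omega
  · omega

theorem tauY_mul_gammaX (hq : IsPrimitiveRoot q a) :
    tauY k a q 0 * gammaX k a q 0 = gammaX k a q 1 * tauY k a q 1 := by
  rw [gammaX, gammaX, tauY, tauY, Finset.mul_sum, Finset.sum_mul]
  refine Finset.sum_congr rfl fun j hj => ?_
  have hj := Finset.mem_range.1 hj
  have h1 := xx_mul_yy k a q (a - 1 - j) j 0 1
  have h2 := xx_mul_yy k a q (a - 1 - j) j 1 0
  simp only [mul_zero, mul_one, pow_zero, one_smul, pow_one] at h1 h2 ⊢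
  rw [sub_mul, mul_sub, mul_smul_comm, smul_mul_assoc, smul_mul_assoc, h1, h2, smul_smul,
    smul_smul, ← pow_succ', ← pow_add, show j + 1 + (a - 1 - j) = a by omega, hq.pow_eq_one,
    one_smul]

theorem gammaY_mul_gammaX (hq : IsPrimitiveRoot q a) :
    gammaY k a q 0 * gammaX k a q 1 = gammaX k a q 0 * gammaY k a q 1 := by
  rw [gammaX, gammaX, gammaY, gammaY, Finset.sum_mul_sum, Finset.sum_mul_sum, Finset.sum_comm]
  refine Finset.sum_congr rfl fun l hl => Finset.sum_congr rfl fun j hj => ?_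
  have hj := Finset.mem_range.1 hj
  have hl := Finset.mem_range.1 hl
  have h := xx_mul_yy k a q (a - 1 - l) l j (a - 1 - j)
  simp only [mul_zero, mul_one, pow_zero, one_smul]
  have h' := congrArg (fun z => q ^ (l * (j + 1) + j) • z) h
  simp only [smul_smul, ← pow_add] at h'
  have e1 : l * (j + 1) + j + l * (a - 1 - j) = a * l + j := by
    obtain ⟨n, rfl⟩ : ∃ n, a = n + 1 + j := ⟨a - 1 - j, by omega⟩
    rw [show n + 1 + j - 1 - j = n by omega]
    ring
  have e2 : l * (j + 1) + j + (a - 1 - l) * j = a * j + l := by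
    obtain ⟨n, rfl⟩ : ∃ n, a = n + 1 + l := ⟨a - 1 - l, by omega⟩
    rw [show n + 1 + l - 1 - l = n by omega]
    ring
  rw [e1, e2, pow_add, pow_add, pow_mul, pow_mul, hq.pow_eq_one, one_pow, one_pow, one_mul,
    one_mul] at h'
  rw [mul_smul_comm, mul_smul_comm, h']

theorem tauY_mul_tauX : tauY k a q 1 * tauX k a q 0 = tauX k a q 1 * tauY k a q 0 := by
  have h1 := xx_mul_yy k a q 0 1 0 1
  have h2 := xx_mul_yy k a q 0 1 1 0
  have h3 := xx_mul_yy k a q 1 0 0 1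
  have h4 := xx_mul_yy k a q 1 0 1 0
  simp only [mul_zero, mul_one, pow_zero, one_smul, pow_one] at h1 h2 h3 h4
  simp only [tauX, tauY, pow_zero, one_smul, pow_one, sub_mul, mul_sub, smul_mul_assoc]
  rw [h1, h2, h3, h4]
  abel

theorem tauX_mul_gammaY (hq : IsPrimitiveRoot q a) :
    tauX k a q 0 * gammaY k a q 0 = gammaY k a q 1 * tauX k a q 1 := by
  rw [gammaY, gammaY, tauX, tauX, Finset.mul_sum, Finset.sum_mul]
  refine Finset.sum_congr rfl fun j hj => ?_
  have hj := Finset.mem_range.1 hj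
  have h1 := xx_mul_yy k a q 1 0 j (a - 1 - j)
  have h2 := xx_mul_yy k a q 0 1 j (a - 1 - j)
  simp only [mul_zero, mul_one, pow_zero, one_smul, pow_one, zero_mul, one_mul] at h1 h2 ⊢
  rw [sub_mul, mul_sub, mul_smul_comm, smul_mul_assoc, smul_mul_assoc, h1, ← h2, smul_smul,
    smul_smul, ← pow_succ', ← pow_add, show j + 1 + (a - 1 - j) = a by omega, hq.pow_eq_one,
    one_smul]

theorem d_comp_d (hq : IsPrimitiveRoot q a) (n : ℕ) : d k a q n ∘ₗ d k a q (n + 1) = 0 := by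
  refine Finsupp.lhom_ext' fun i => LinearMap.ext_ring ?_
  change d k a q n (d k a q (n + 1) (Finsupp.single i 1)) = 0
  rw [d_single]
  generalize ((i : ℕ) : ℤ) = i
  have hi : Even (i - 1) ↔ ¬ Even i := by rw [Int.even_sub]; simp
  have hn : Even (n + 1 + 1) ↔ ¬ Even (n + 1) := Nat.even_add_one
  by_cases h1 : Even (n + 1) <;> by_cases h2 : Even i
  · have e : dgen k a q (n + 1) i = tauY k a q 0 • gen k a q (n + 1) i
        + gammaX k a q 1 • gen k a q (n + 1) (i - 1) := by simp [dgen, hn, h1, h2]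
    have e1 : dgen k a q n i = gammaY k a q 0 • gen k a q n i
        + gammaX k a q 0 • gen k a q n (i - 1) := by simp [dgen, h1, h2]
    have e2 : dgen k a q n (i - 1) = -tauY k a q 1 • gen k a q n (i - 1)
        + tauX k a q 1 • gen k a q n (i - 1 - 1) := by simp [dgen, h1, hi, h2]
    rw [e, map_add, map_smul, map_smul, d_gen, d_gen, e1, e2, smul_add, smul_add, smul_smul,
      smul_smul, smul_smul, smul_smul, tauY_mul_gammaY, gammaX_mul_tauX, tauY_mul_gammaX hq,
      mul_neg, neg_smul]
    simp
  · have e : dgen k a q (n + 1) i = -gammaY k a q 1 • gen k a q (n + 1) i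
        + tauX k a q 0 • gen k a q (n + 1) (i - 1) := by simp [dgen, hn, h1, h2]
    have e1 : dgen k a q n i = -tauY k a q 1 • gen k a q n i
        + tauX k a q 1 • gen k a q n (i - 1) := by simp [dgen, h1, h2]
    have e2 : dgen k a q n (i - 1) = gammaY k a q 0 • gen k a q n (i - 1)
        + gammaX k a q 0 • gen k a q n (i - 1 - 1) := by simp [dgen, h1, hi, h2]
    rw [e, map_add, map_smul, map_smul, d_gen, d_gen, e1, e2, smul_add, smul_add, smul_smul,
      smul_smul, smul_smul, smul_smul, neg_mul_neg, gammaY_mul_tauY, tauX_mul_gammaX,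
      tauX_mul_gammaY hq, neg_mul, neg_smul]
    simp
  · have e : dgen k a q (n + 1) i = gammaY k a q 0 • gen k a q (n + 1) i
        + gammaX k a q 0 • gen k a q (n + 1) (i - 1) := by simp [dgen, hn, h1, h2]
    have e1 : dgen k a q n i = tauY k a q 0 • gen k a q n i
        + gammaX k a q 1 • gen k a q n (i - 1) := by simp [dgen, h1, h2]
    have e2 : dgen k a q n (i - 1) = -gammaY k a q 1 • gen k a q n (i - 1)
        + tauX k a q 0 • gen k a q n (i - 1 - 1) := by simp [dgen, h1, hi, h2]
    rw [e, map_add, map_smul, map_smul, d_gen, d_gen, e1, e2, smul_add, smul_add, smul_smul,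
      smul_smul, smul_smul, smul_smul, gammaY_mul_tauY, gammaX_mul_tauX, gammaY_mul_gammaX hq,
      mul_neg, neg_smul]
    simp
  · have e : dgen k a q (n + 1) i = -tauY k a q 1 • gen k a q (n + 1) i
        + tauX k a q 1 • gen k a q (n + 1) (i - 1) := by simp [dgen, hn, h1, h2]
    have e1 : dgen k a q n i = -gammaY k a q 1 • gen k a q n i
        + tauX k a q 0 • gen k a q n (i - 1) := by simp [dgen, h1, h2]
    have e2 : dgen k a q n (i - 1) = tauY k a q 0 • gen k a q n (i - 1)
        + gammaX k a q 1 • gen k a q n (i - 1 - 1) := by simp [dgen, h1, hi, h2]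
    rw [e, map_add, map_smul, map_smul, d_gen, d_gen, e1, e2, smul_add, smul_add, smul_smul,
      smul_smul, smul_smul, smul_smul, neg_mul_neg, tauY_mul_gammaY, tauX_mul_gammaX, neg_mul,
      tauY_mul_tauX, neg_smul]
    simp

/-- A sufficient condition for the cochain `f^{2t}_i ↦ p i` to be a cocycle. -/
theorem cochain_comp_d (t : ℕ) (p : ℕ → QCI k a q)
    (h0 : ∀ i, Even i → tauY k a q 0 • p i = 0 ∧ tauX k a q 0 • p i = 0)
    (h1 : ∀ i, ¬ Even i → gammaY k a q 1 • p i = 0 ∧ gammaX k a q 1 • p i = 0) :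
    cochain k a q (2 * t) p ∘ₗ d k a q (2 * t) = 0 := by
  refine Finsupp.lhom_ext' fun i => LinearMap.ext_ring ?_
  change cochain k a q (2 * t) p (d k a q (2 * t) (Finsupp.single i 1)) = 0
  have hn : ¬ Even (2 * t + 1) := by simp
  rw [d_single, dgen, if_neg hn]
  generalize hj : ((i : ℕ) : ℤ) = j
  have h0' : ∀ i : ℤ, Even i → tauY k a q 0 • cochain k a q (2 * t) p (gen k a q (2 * t) i) = 0 ∧
      tauX k a q 0 • cochain k a q (2 * t) p (gen k a q (2 * t) i) = 0 := by
    intro i hi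
    rw [cochain_gen]
    split_ifs with h
    · refine h0 _ ?_
      rw [← Int.even_coe_nat, Int.toNat_of_nonneg h.1]
      exact hi
    · simp
  have h1' : ∀ i : ℤ, ¬ Even i →
      gammaY k a q 1 • cochain k a q (2 * t) p (gen k a q (2 * t) i) = 0 ∧
      gammaX k a q 1 • cochain k a q (2 * t) p (gen k a q (2 * t) i) = 0 := by
    intro i hi
    rw [cochain_gen]
    split_ifs with h
    · refine h1 _ ?_
      rw [← Int.even_coe_nat, Int.toNat_of_nonneg h.1]
      exact hi
    · simp
  have hi : Even (j - 1) ↔ ¬ Even j := by rw [Int.even_sub]; simp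
  split_ifs with h
  · rw [map_add, map_smul, map_smul, (h0' j h).1, (h1' (j - 1) (by rw [hi]; simpa using h)).2,
      add_zero]
  · rw [map_add, map_smul, map_smul, neg_smul, (h1' j h).1, (h0' (j - 1) (hi.2 h)).2,
      neg_zero, add_zero]

theorem xx_smul (i j : ℕ) (m : QCI k a q) :
    xx k a q i j • m = x k a q ^ i * m * x k a q ^ j := tens_smul k _ _ _

theorem yy_smul (i j : ℕ) (m : QCI k a q) :
    yy k a q i j • m = y k a q ^ i * m * y k a q ^ j := tens_smul k _ _ _

theorem tauY_smul (s : ℕ) (m : QCI k a q) :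
    tauY k a q s • m = m * y k a q - q ^ s • (y k a q * m) := by
  rw [tauY, sub_smul, smul_assoc, yy_smul, yy_smul]
  simp

theorem tauX_smul (s : ℕ) (m : QCI k a q) :
    tauX k a q s • m = q ^ s • (m * x k a q) - x k a q * m := by
  rw [tauX, sub_smul, smul_assoc, xx_smul, xx_smul]
  simp

theorem gammaX_smul (s : ℕ) (m : QCI k a q) : gammaX k a q s • m =
    ∑ j ∈ Finset.range a, q ^ (j * s) • (x k a q ^ (a - 1 - j) * m * x k a q ^ j) := by
  rw [gammaX, Finset.sum_smul]
  exact Finset.sum_congr rfl fun j _ => by rw [smul_assoc, xx_smul]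

theorem gammaY_smul (s : ℕ) (m : QCI k a q) : gammaY k a q s • m =
    ∑ j ∈ Finset.range a, q ^ (j * s) • (y k a q ^ j * m * y k a q ^ (a - 1 - j)) := by
  rw [gammaY, Finset.sum_smul]
  exact Finset.sum_congr rfl fun j _ => by rw [smul_assoc, yy_smul]

/-- The values of `ζ_j`. -/
def zetaVal (k : Type u) [Field k] (a : ℕ) (q : k) (j i : ℕ) : QCI k a q :=
  if i = j then 1 else 0

/-- The values of `η_j^+`. -/
def etaPlusVal (k : Type u) [Field k] (a : ℕ) (q : k) (j i : ℕ) : QCI k a q :=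
  if i = j then x k a q ^ (a - 1) * y k a q ^ (a - 1) else 0

/-- The values of `η_j^-`. -/
def etaMinusVal (k : Type u) [Field k] (a : ℕ) (q : k) (j i : ℕ) : QCI k a q :=
  if i = j then x k a q * y k a q else 0

theorem zeta_cocycle (ha : 3 ≤ a) (hq : IsPrimitiveRoot q a) (t j : ℕ) :
    cochain k a q (2 * t) (zetaVal k a q j) ∘ₗ d k a q (2 * t) = 0 := by
  refine cochain_comp_d t _ (fun i hi => ?_) (fun i hi => ?_) <;> rw [zetaVal] <;> split_ifs
  · rw [tauX_smul, tauY_smul]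
    simp
  · simp
  · rw [gammaX_smul, gammaY_smul]
    have hs := hq.geom_sum_eq_zero (show 1 < a by omega)
    constructor
    · rw [← zero_smul k (y k a q ^ (a - 1)), ← hs, Finset.sum_smul]
      refine Finset.sum_congr rfl fun j hj => ?_
      have hj := Finset.mem_range.1 hj
      rw [mul_one, mul_one, ← pow_add, show j + (a - 1 - j) = a - 1 by omega]
    · rw [← zero_smul k (x k a q ^ (a - 1)), ← hs, Finset.sum_smul]
      refine Finset.sum_congr rfl fun j hj => ?_
      have hj := Finset.mem_range.1 hj
      rw [mul_one, mul_one, ← pow_add, show a - 1 - j + j = a - 1 by omega]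
  · simp

theorem etaPlus_cocycle (ha : 3 ≤ a) (hq : IsPrimitiveRoot q a) (t : ℕ) {j : ℕ} (hj : Even j) :
    cochain k a q (2 * t) (etaPlusVal k a q j) ∘ₗ d k a q (2 * t) = 0 := by
  have hq0 : q ≠ 0 := hq.ne_zero (by omega)
  have hx : x k a q * x k a q ^ (a - 1) = 0 := by
    rw [← pow_succ', show a - 1 + 1 = a by omega, x_pow]
  have hy : y k a q ^ (a - 1) * y k a q = 0 := by
    rw [← pow_succ, show a - 1 + 1 = a by omega, y_pow]
  have hyx : y k a q ^ (a - 1) * x k a q = (q ^ (a - 1))⁻¹ • (x k a q * y k a q ^ (a - 1)) := by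
    rw [x_mul_y_pow, smul_smul, inv_mul_cancel₀ (pow_ne_zero _ hq0), one_smul]
  have hxy : y k a q * x k a q ^ (a - 1) = (q ^ (a - 1))⁻¹ • (x k a q ^ (a - 1) * y k a q) := by
    have := x_pow_mul_y_pow k a q (a - 1) 1
    rw [pow_one, mul_one] at this
    rw [this, smul_smul, inv_mul_cancel₀ (pow_ne_zero _ hq0), one_smul]
  have hx' : x k a q ^ (a - 1) * x k a q = 0 := by rw [← pow_succ, pow_succ', hx]
  have hy' : y k a q * y k a q ^ (a - 1) = 0 := by rw [← pow_succ', pow_succ, hy]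
  refine cochain_comp_d t _ (fun i hi => ?_) (fun i hi => ?_) <;> rw [etaPlusVal] <;>
    split_ifs with h
  · rw [tauX_smul, tauY_smul]
    constructor
    · rw [mul_assoc, hy, ← mul_assoc, hxy, smul_mul_assoc, mul_assoc, hy']
      simp
    · rw [mul_assoc, hyx, mul_smul_comm, ← mul_assoc, hx', ← mul_assoc, hx]
      simp
  · simp
  · exact absurd (h ▸ hj) hi
  · simp

theorem etaMinus_cocycle (t : ℕ) {j : ℕ} (hj : ¬ Even j) :
    cochain k a q (2 * t) (etaMinusVal k a q j) ∘ₗ d k a q (2 * t) = 0 := by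
  refine cochain_comp_d t _ (fun i hi => ?_) (fun i hi => ?_) <;> rw [etaMinusVal] <;>
    split_ifs with h
  · exact absurd (h ▸ hi) hj
  · simp
  · rw [gammaX_smul, gammaY_smul]
    constructor
    · refine Finset.sum_eq_zero fun l hl => ?_
      have hl := Finset.mem_range.1 hl
      have e := x_mul_y_pow k a q l
      rw [mul_one, ← mul_assoc, ← smul_mul_assoc, ← smul_mul_assoc, ← e, mul_assoc, mul_assoc,
        ← pow_succ', ← pow_add, show l + (a - 1 - l + 1) = a by omega, y_pow, mul_zero]
    · refine Finset.sum_eq_zero fun l hl => ?_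
      have hl := Finset.mem_range.1 hl
      have e := x_pow_mul_y_pow k a q l 1
      rw [mul_one, pow_one] at e
      rw [mul_one, ← mul_assoc, ← pow_succ, mul_assoc, ← mul_smul_comm, ← e, ← mul_assoc,
        ← pow_add, show a - 1 - l + 1 + l = a by omega, x_pow, zero_mul]
  · simp

/-- The complex `⋯ → P_2 → P_1 → P_0` of `Aᵉ`-modules. -/
def resolutionComplex (hq : IsPrimitiveRoot q a) : ChainComplex (ModuleCat.{u} (E k a q)) ℕ :=
  ChainComplex.of (fun n => ModuleCat.of (E k a q) (P k a q n)) (fun n => ModuleCat.ofHom (d k a q n))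
    fun n => by
      rw [← ModuleCat.ofHom_comp, d_comp_d hq]
      rfl

theorem resolutionComplex_d (hq : IsPrimitiveRoot q a) (n : ℕ) :
    (resolutionComplex hq).d (n + 1) n = ModuleCat.ofHom (d k a q n) :=
  ChainComplex.of_d (fun n => ModuleCat.of (E k a q) (P k a q n))
    (fun n => ModuleCat.ofHom (d k a q n)) n

/-- The map `P_n → A` with `f^n_i ↦ p i`, as a morphism from the term of degree `n`. -/
def cochainHom (hq : IsPrimitiveRoot q a) (n : ℕ) (p : ℕ → QCI k a q) :
    (resolutionComplex hq).X n ⟶ bimod k (QCI k a q) :=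
  ModuleCat.ofHom (cochain k a q n p)

theorem d_comp_cochainHom (hq : IsPrimitiveRoot q a) (n : ℕ) (p : ℕ → QCI k a q)
    (h : cochain k a q n p ∘ₗ d k a q n = 0) :
    (resolutionComplex hq).d (n + 1) n ≫ cochainHom hq n p = 0 := by
  rw [resolutionComplex_d, cochainHom]
  exact (ModuleCat.ofHom_comp _ _).symm.trans (congrArg ModuleCat.ofHom h)

theorem d_comp_mu (hq : IsPrimitiveRoot q a) :
    (resolutionComplex hq).d 1 0 ≫ cochainHom hq 0 (fun _ => 1) = 0 := by
  refine d_comp_cochainHom hq 0 _ ?_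
  refine Finsupp.lhom_ext' fun i => LinearMap.ext_ring ?_
  change cochain k a q 0 (fun _ => 1) (d k a q 0 (Finsupp.single i 1)) = 0
  rw [d_single]
  fin_cases i
  · simp [dgen, cochain_gen, tauY_smul]
  · simp [dgen, cochain_gen, tauX_smul]

/-- The augmentation of the complex, given by `μ : P_0 → A`, `u ⊗ v ↦ u * v`. -/
def augmentation (hq : IsPrimitiveRoot q a) :
    resolutionComplex hq ⟶ (ChainComplex.single₀ _).obj (bimod k (QCI k a q)) :=
  (ChainComplex.toSingle₀Equiv _ _).symm ⟨cochainHom hq 0 fun _ => 1, d_comp_mu hq⟩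

/-- The projective bimodule resolution of `A`, if the augmented complex is exact. -/
def resolution (hq : IsPrimitiveRoot q a) (hP : QuasiIso (augmentation hq)) :
    ProjectiveResolution (bimod k (QCI k a q)) where
  complex := resolutionComplex hq
  projective n := inferInstanceAs (Projective (ModuleCat.of (E k a q) (P k a q n)))
  π := augmentation hq
  quasiIso := hP

section Classes

variable (ha : 3 ≤ a) (hq : IsPrimitiveRoot q a) (hP : QuasiIso (augmentation hq))

/-- The class `ζ_j^{2t}` in `HH^{2t}(A)` of the map `f^{2t}_i ↦ δ_{ij}`. -/
def zeta (t j : ℕ) : EvenRing k (QCI k a q) :=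
  DirectSum.of (EvenCoh k (QCI k a q)) t
    ((resolution hq hP).extMk (cochainHom hq (2 * t) (zetaVal k a q j)) (2 * t + 1) rfl
      (d_comp_cochainHom hq _ _ (zeta_cocycle ha hq t j)))

/-- For `j` even, the class of `η_j^+` in `HH^{2t}(A)`, i.e. of
`f^{2t}_i ↦ δ_{ij} x^{a-1} y^{a-1}`. -/
def etaPlus (t : ℕ) {j : ℕ} (hj : Even j) : EvenRing k (QCI k a q) :=
  DirectSum.of (EvenCoh k (QCI k a q)) t
    ((resolution hq hP).extMk (cochainHom hq (2 * t) (etaPlusVal k a q j)) (2 * t + 1) rfl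
      (d_comp_cochainHom hq _ _ (etaPlus_cocycle ha hq t hj)))

/-- For `j` odd, the class of `η_j^-` in `HH^{2t}(A)`, i.e. of `f^{2t}_i ↦ δ_{ij} x y`. -/
def etaMinus (t : ℕ) {j : ℕ} (hj : ¬ Even j) : EvenRing k (QCI k a q) :=
  DirectSum.of (EvenCoh k (QCI k a q)) t
    ((resolution hq hP).extMk (cochainHom hq (2 * t) (etaMinusVal k a q j)) (2 * t + 1) rfl
      (d_comp_cochainHom hq _ _ (etaMinus_cocycle t hj)))

/-- `R_0`, the span of all `ζ_i^{2t}` with `0 ≤ i ≤ 2t` even. -/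
def R0 : Submodule k (EvenRing k (QCI k a q)) :=
  Submodule.span k {z | ∃ t i : ℕ, i ≤ 2 * t ∧ Even i ∧ z = zeta ha hq hP t i}

/-- `R_1`, the span of all `ζ_i^{2t}` with `0 ≤ i ≤ 2t` odd. -/
def R1 : Submodule k (EvenRing k (QCI k a q)) :=
  Submodule.span k {z | ∃ t i : ℕ, i ≤ 2 * t ∧ ¬ Even i ∧ z = zeta ha hq hP t i}

end Classes

end QCI

end HH
end

/-! Everything follows from an internal grading. With `x` and `y` of degree one, every entry of the
differential is homogeneous once `f^n_i` is given degree `wt i + wt (n - i)`, where `wt` grows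
alternately by `1` (a step `τ`) and `a - 1` (a step `γ`). A cocycle sending `f^{2t}_i` to an element
of degree `m` then has degree `m - wt i - wt (2t - i)`. For `i` even this is `m - at`, for `i` odd
it is `m - at + (a - 2)`. After adding `at` in cohomological degree `2t`, the even ring therefore
lives in degrees from `0` to `3a - 4`. Degree zero is spanned by the `ζ_i` with `i` even; the odd
ones have degree `a - 2`, which is positive because `a ≥ 3`.

The code uses filtrations instead of gradings. The elements of shifted degree at least `w` form
`filRing hP w`. This filtration is multiplicative (`mul_mem_filRing`), starts with the whole ring
(`mem_filRing_zero`) and vanishes from `3a - 3` on (`filRing_eq_zero`). Hence `filRing hP 1` is a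
nilpotent two-sided ideal. It contains `R_1` and all `η`, and it is complementary to `R_0`. For even
`j` the cocycle `ζ_j` lifts to the index shift `f_i ↦ f_{i-j}`, so these classes multiply like
monomials and `R_0` is a polynomial ring. As the quotient by `filRing hP 1` is a domain, every
nilpotent ideal lies in `filRing hP 1`, which is the required `N`.

Three ingredients carry this. The Yoneda product is computed by lifting a cocycle to a chain map
(`extMk_comp_extMk`). The complex is exact, and strictly so: a cycle of degree at least `v` bounds
an element of degree at least `v` (`exists_d_eq`), so lifts can be chosen compatible with degrees
(`exists_lift`). Coboundaries have no constant terms (`Represents.apply_mem_filA_one`), so the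
constant term of a class at a generator is well defined and detects `R_0`. -/

noncomputable section

/-! ### Yoneda products computed by chain maps that lift a cocycle. -/

namespace CategoryTheory.ProjectiveResolution

open CochainComplex HomComplex Abelian

universe w v u'

variable {C : Type u'} [Category.{v} C] [Abelian C] {X Y : C}
  (R : ProjectiveResolution X)

theorem isZero_cochainComplex_X (p : ℤ) (hp : 0 < p) :
    Limits.IsZero (R.cochainComplex.X p) :=
  CochainComplex.isZero_of_isStrictlyLE _ 0 _ hp

section

variable {R} {n : ℕ} (φ : ∀ i : ℕ, R.complex.X (n + i) ⟶ R.complex.X i)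

open Classical in
/-- The components of the map of degree `n` of the extended complex given by `φ`. -/
def chainLiftHomF (p : ℤ) : R.cochainComplex.X p ⟶ R.cochainComplex.X (p + n) :=
  if h : ∃ i : ℕ, p = -((n + i : ℕ) : ℤ) then
    (R.cochainComplexXIso p (n + h.choose) h.choose_spec.symm).hom ≫ φ h.choose ≫
      (R.cochainComplexXIso (p + n) h.choose (by have := h.choose_spec; lia)).inv
  else 0

theorem chainLiftHomF_eq (p : ℤ) (i : ℕ) (hi : -((n + i : ℕ) : ℤ) = p) :
    chainLiftHomF φ p = (R.cochainComplexXIso p (n + i) hi).hom ≫ φ i ≫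
      (R.cochainComplexXIso (p + n) i (by lia)).inv := by
  have h : ∃ i : ℕ, p = -((n + i : ℕ) : ℤ) := ⟨i, hi.symm⟩
  obtain rfl : i = h.choose := by have := h.choose_spec; lia
  rw [chainLiftHomF, dif_pos h]

/-- The morphism of degree `n` given by a lift of a cocycle, for `n` even. -/
def chainLiftHom (hn : Even n)
    (hφ : ∀ i, R.complex.d (n + (i + 1)) (n + i) ≫ φ i = φ (i + 1) ≫ R.complex.d (i + 1) i) :
    R.cochainComplex ⟶ R.cochainComplex⟦(n : ℤ)⟧ where
  f p := chainLiftHomF φ p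
  comm' p p' hp := by
    have hp' : p + 1 = p' := hp
    by_cases h : 0 < p' + n
    -- The resolution occupies nonpositive degrees, so here the target of the square vanishes.
    · exact (R.isZero_cochainComplex_X _ h).eq_of_tgt _ _
    obtain ⟨i, hi⟩ : ∃ i : ℕ, -((n + i : ℕ) : ℤ) = p' := ⟨(-p' - n).toNat, by lia⟩
    have hi' : -((n + (i + 1) : ℕ) : ℤ) = p := by lia
    -- The shifted differential carries the sign `(-1)^n`; evenness of `n` removes it.
    rw [CochainComplex.shiftFunctor_obj_d', Int.negOnePow_even _ (by exact_mod_cast hn), one_smul]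
    change chainLiftHomF φ p ≫ R.cochainComplex.d (p + n) (p' + n) =
      R.cochainComplex.d p p' ≫ chainLiftHomF φ p'
    rw [chainLiftHomF_eq φ p _ hi', chainLiftHomF_eq φ p' _ hi,
      R.cochainComplex_d (p + n) (p' + n) (i + 1) i (by lia) (by lia),
      R.cochainComplex_d p p' (n + (i + 1)) (n + i) (by lia) (by lia)]
    simp [reassoc_of% hφ i]

end

/-- A complex concentrated in one degree leaves room for a single nonzero component. -/
theorem cochain_toSingle_ext {K : CochainComplex C ℤ} {n p q : ℤ} (h : p + n = q)
    {α β : Cochain K ((singleFunctor C q).obj X) n} (e : α.v p q h = β.v p q h) : α = β := by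
  apply (Cochain.toSingleEquiv h).injective
  change α.v p q h ≫ _ = β.v p q h ≫ _
  rw [e]

theorem equivHomShift_v {K L : CochainComplex C ℤ} {n : ℤ} (f : K ⟶ L⟦n⟧) (p q : ℤ)
    (h : p + n = q) : (Cocycle.equivHomShift f).1.v p q h =
      f.f p ≫ (L.shiftFunctorObjXIso n p q h.symm).hom := by
  rw [Cocycle.equivHomShift_apply, Cocycle.rightUnshift_coe,
    Cochain.rightUnshift_v _ _ _ _ _ _ _ (add_zero p)]
  simp

theorem equivHomShift_symm_f {K L : CochainComplex C ℤ} {n : ℤ} (z : Cocycle K L n) (p q : ℤ)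
    (h : p + n = q) : (Cocycle.equivHomShift.symm z).f p =
      z.1.v p q h ≫ (L.shiftFunctorObjXIso n p q h.symm).inv := by
  obtain ⟨f, rfl⟩ := Cocycle.equivHomShift.surjective z
  rw [equivHomShift_v, AddEquiv.symm_apply_apply]
  exact ((Iso.eq_comp_inv _).2 rfl)

theorem cochainComplexXIso_inv_comp (p q : ℤ) (i : ℕ) (h : -(i : ℤ) = p) (hpq : p = q) :
    (R.cochainComplexXIso p i h).inv ≫ (HomologicalComplex.XIsoOfEq _ hpq).hom =
      (R.cochainComplexXIso q i (h.trans hpq)).inv := by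
  subst hpq
  simp

theorem cochainComplexXIso_inv_comp_toSingleMk_v {m : ℕ} (g : R.complex.X m ⟶ Y) (p : ℤ)
    (hp : -(m : ℤ) = p) :
    (R.cochainComplexXIso p m hp).inv ≫
      (Cochain.toSingleMk ((R.cochainComplexXIso (-m : ℤ) m rfl).hom ≫ g)
        (by simp : (-m : ℤ) + m = 0)).v p 0 (by lia) =
      g ≫ (HomologicalComplex.singleObjXSelf (.up ℤ) 0 Y).inv := by
  subst hp
  rw [Cochain.toSingleMk_v, Category.assoc]
  exact Iso.inv_hom_id_assoc _ _

theorem eq_comp_XIsoOfEq (K : CochainComplex C ℤ) {W : C} {p q r : ℤ} (f : W ⟶ K.X r)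
    (h₁ : p = r) (h₂ : p = q) (h₃ : q = r) :
    f = f ≫ (K.XIsoOfEq h₁).inv ≫ (K.XIsoOfEq h₂).hom ≫ (K.XIsoOfEq h₃).hom := by
  subst h₁ h₂
  simp

/-- Meant for `t` the augmentation of a resolution in the derived category and `s` its inverse:
between two classes written on the resolution, the augmentation and its inverse cancel. -/
theorem shiftedHom_comp_comp {D : Type*} [Category* D] [HasShift D ℤ] {S K S' K' : D}
    (s : S ⟶ K) (t : K ⟶ S) (ts : t ≫ s = 𝟙 K) (r : K' ⟶ S') {n m c : ℤ} (h : m + n = c)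
    (f : ShiftedHom K K n) (g : ShiftedHom K K' m) :
    ((ShiftedHom.mk₀ (0 : ℤ) rfl s).comp (f.comp (ShiftedHom.mk₀ (0 : ℤ) rfl t) (zero_add n))
        (add_zero n)).comp
      ((ShiftedHom.mk₀ (0 : ℤ) rfl s).comp (g.comp (ShiftedHom.mk₀ (0 : ℤ) rfl r) (zero_add m))
        (add_zero m)) h =
    (ShiftedHom.mk₀ (0 : ℤ) rfl s).comp ((f.comp g h).comp
      (ShiftedHom.mk₀ (0 : ℤ) rfl r) (zero_add c)) (add_zero c) := by
  simp only [ShiftedHom.mk₀_comp, ShiftedHom.comp_mk₀]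
  simp only [ShiftedHom.comp, Functor.map_comp, Category.assoc]
  rw [← Functor.map_comp_assoc, ts, Functor.map_id, Category.id_comp]
  congr 3
  exact (shiftFunctorAdd' D m n c h).inv.naturality r

theorem cochainComplex_d_comp_cocycle {n : ℕ} (f : R.complex.X n ⟶ Y)
    (hf : R.complex.d (n + 1) n ≫ f = 0) :
    R.cochainComplex.d (-(n + 1 : ℕ) : ℤ) (-n : ℤ) ≫
      (R.cochainComplexXIso (-n : ℤ) n rfl).hom ≫ f = 0 := by
  rw [R.cochainComplex_d _ _ (n + 1) n rfl rfl]
  simp [hf]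

variable [HasExt.{w} C]

/-- In the derived category a class is its cocycle precomposed with the inverse of the augmentation.
The lift `φ` becomes a morphism from the resolution to its shift; followed by the augmentation it is
`f`, and followed by `g` it is the cocycle `φ m ≫ g`. The inner augmentation then cancels. -/
theorem extMk_comp_extMk {n : ℕ} (hn : Even n)
    (f : R.complex.X n ⟶ X) (hf : R.complex.d (n + 1) n ≫ f = 0)
    (φ : ∀ i : ℕ, R.complex.X (n + i) ⟶ R.complex.X i)
    (hφ0 : φ 0 ≫ R.π.f 0 = f)
    (hφ : ∀ i, R.complex.d (n + (i + 1)) (n + i) ≫ φ i = φ (i + 1) ≫ R.complex.d (i + 1) i)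
    {m : ℕ} (g : R.complex.X m ⟶ Y) (hg : R.complex.d (m + 1) m ≫ g = 0)
    (hfg : R.complex.d (n + m + 1) (n + m) ≫ φ m ≫ g = 0) :
    (R.extMk f (n + 1) rfl hf).comp (R.extMk g (m + 1) rfl hg) rfl =
      R.extMk (φ m ≫ g) (n + m + 1) rfl hfg := by
  have := HasDerivedCategory.standard C
  -- The cocycle `f` is the lift followed by the augmentation; only the component in degree `-n`
  -- matters, where this is `hφ0`.
  have h1 : Cocycle.equivHomShift.symm (Cocycle.toSingleMk
      ((R.cochainComplexXIso (-n) n rfl).hom ≫ f) (by simp : (-n : ℤ) + n = 0) (-(n + 1 : ℕ))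
        (by lia) (R.cochainComplex_d_comp_cocycle f hf)) =
      ShiftedHom.comp (b := (0 : ℤ)) (chainLiftHom φ hn hφ) (ShiftedHom.mk₀ 0 rfl R.π')
        (zero_add _) := by
    apply Cocycle.equivHomShift.injective
    rw [ShiftedHom.comp_mk₀, Cocycle.equivHomShift_comp_shift, AddEquiv.apply_symm_apply]
    ext1
    apply cochain_toSingle_ext (by simp : (-n : ℤ) + n = 0)
    rw [Cocycle.toSingleMk_coe, Cochain.toSingleMk_v, Cocycle.postcomp_coe,
      Cochain.comp_v _ _ _ (-n) 0 0 (by simp) (by simp), equivHomShift_v, Cochain.ofHom_v]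
    change _ = (chainLiftHomF φ (-n) ≫ _) ≫ _
    rw [chainLiftHomF_eq φ _ 0 (by simp), π'_f_zero]
    change _ = (((R.cochainComplexXIso (-n) n rfl).hom ≫ φ 0 ≫
      (R.cochainComplexXIso (-n + n) 0 (by simp)).inv) ≫
      (HomologicalComplex.XIsoOfEq _ (by simp : (-n + n : ℤ) = 0)).hom) ≫ _
    simp only [Category.assoc]
    rw [reassoc_of% R.cochainComplexXIso_inv_comp, Iso.inv_hom_id_assoc, ← hφ0]
    exact congrArg (_ ≫ ·) (Category.assoc _ _ _)
  -- The cocycle `φ m ≫ g` is the lift followed by the cocycle of `g`, again checked in the single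
  -- relevant degree.
  have h2 : Cocycle.equivHomShift.symm (Cocycle.toSingleMk
      ((R.cochainComplexXIso (-(n + m : ℕ)) (n + m) rfl).hom ≫ φ m ≫ g)
        (by simp : (-(n + m : ℕ) : ℤ) + (n + m : ℕ) = 0) (-(n + m + 1 : ℕ))
        (by lia) (R.cochainComplex_d_comp_cocycle _ hfg)) =
      ShiftedHom.comp (chainLiftHom φ hn hφ) (Cocycle.equivHomShift.symm (Cocycle.toSingleMk
        ((R.cochainComplexXIso (-m) m rfl).hom ≫ g) (by simp : (-m : ℤ) + m = 0) (-(m + 1 : ℕ))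
        (by lia) (R.cochainComplex_d_comp_cocycle g hg))) (by push_cast; ring) := by
    apply Cocycle.equivHomShift.injective
    rw [AddEquiv.apply_symm_apply]
    ext1
    apply cochain_toSingle_ext (by simp : (-(n + m : ℕ) : ℤ) + (n + m : ℕ) = 0)
    rw [Cocycle.toSingleMk_coe, Cochain.toSingleMk_v, equivHomShift_v, ShiftedHom.comp,
      HomologicalComplex.comp_f, HomologicalComplex.comp_f, CochainComplex.shiftFunctor_map_f',
      CochainComplex.shiftFunctorAdd'_inv_app_f', equivHomShift_symm_f _ _ 0 (by simp)]
    change _ = (chainLiftHomF φ _ ≫ _) ≫ _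
    rw [chainLiftHomF_eq φ _ m rfl, Cocycle.toSingleMk_coe]
    change _ = (((R.cochainComplexXIso (-(n + m : ℕ)) (n + m) rfl).hom ≫ φ m ≫
      (R.cochainComplexXIso (-(n + m : ℕ) + n) m (by simp)).inv) ≫
      ((Cochain.toSingleMk ((R.cochainComplexXIso (-m : ℤ) m rfl).hom ≫ g)
        (by simp : (-m : ℤ) + m = 0)).v (-(n + m : ℕ) + n) 0 (by simp) ≫
        (HomologicalComplex.XIsoOfEq _ (by simp : (-(n + m : ℕ) + n + m : ℤ) = 0)).inv) ≫
      (HomologicalComplex.XIsoOfEq _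
        (by simp : (-(n + m : ℕ) + n + m : ℤ) = -(n + m : ℕ) + (n + m : ℕ))).hom) ≫
      (HomologicalComplex.XIsoOfEq _ (by simp : (-(n + m : ℕ) + (n + m : ℕ) : ℤ) = 0)).hom
    simp only [Category.assoc]
    rw [reassoc_of% R.cochainComplexXIso_inv_comp_toSingleMk_v g]
    exact congrArg
      (fun z => (R.cochainComplexXIso (-(n + m : ℕ) : ℤ) (n + m) rfl).hom ≫ φ m ≫ z)
      (eq_comp_XIsoOfEq ((singleFunctor C 0).obj Y) (g ≫ _) _ _ _)
  ext
  rw [Ext.comp_hom, extMk_hom, extMk_hom, extMk_hom, h1, h2, ShiftedHom.map_comp,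
    ShiftedHom.map_comp, ShiftedHom.map_mk₀]
  generalize ShiftedHom.map (chainLiftHom φ hn hφ) DerivedCategory.Q = A
  rw [ShiftedHom.comp_assoc A _ _ _ (zero_add _) (by simp), ShiftedHom.mk₀_comp_mk₀]
  exact shiftedHom_comp_comp _ _ (by simp) _ _ _ _

end CategoryTheory.ProjectiveResolution
end

/-! ### Monomial bases of `A` and `Aᵉ`, and the filtrations by degree. -/

noncomputable section

namespace HH

section Model

variable (k : Type u) [Field k] (a : ℕ) (q : k)

/-- The operator of `Y` on the free module with basis the monomials `y^b x^c`. -/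
def modelY : Module.End k (ℕ × ℕ →₀ k) :=
  Finsupp.linearCombination k fun p : ℕ × ℕ =>
    if p.1 + 1 < a then Finsupp.single (p.1 + 1, p.2) (1 : k) else 0

/-- The operator of `X` on the free module with basis the monomials `y^b x^c`. -/
def modelX : Module.End k (ℕ × ℕ →₀ k) :=
  Finsupp.linearCombination k fun p : ℕ × ℕ =>
    if p.2 + 1 < a then Finsupp.single (p.1, p.2 + 1) (q ^ p.1) else 0

theorem modelY_single (b c : ℕ) (r : k) : modelY k a (Finsupp.single (b, c) r) =
    if b + 1 < a then Finsupp.single (b + 1, c) r else 0 := by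
  rw [modelY, Finsupp.linearCombination_single]
  split_ifs <;> simp

theorem modelX_single (b c : ℕ) (r : k) : modelX k a q (Finsupp.single (b, c) r) =
    if c + 1 < a then Finsupp.single (b, c + 1) (q ^ b * r) else 0 := by
  rw [modelX, Finsupp.linearCombination_single]
  split_ifs <;> simp [mul_comm]

/-- The module has basis vectors for all pairs of exponents, also those at least `a`, and on these
the zeroth power is still the identity. Hence the alternative `n = 0`. -/
theorem modelY_pow_single (n b c : ℕ) (r : k) : (modelY k a ^ n) (Finsupp.single (b, c) r) =
    if n = 0 ∨ b + n < a then Finsupp.single (b + n, c) r else 0 := by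
  induction n with
  | zero => simp
  | succ n ih =>
    rw [pow_succ', Module.End.mul_apply, ih]
    simp only [Nat.add_eq_zero_iff, one_ne_zero, and_false, false_or]
    split_ifs with h1 h2 h2
    · rw [modelY_single, if_pos (by omega)]
      rfl
    · rw [modelY_single, if_neg (by omega)]
    · omega
    · rw [map_zero]

theorem modelX_pow_single (n b c : ℕ) (r : k) : (modelX k a q ^ n) (Finsupp.single (b, c) r) =
    if n = 0 ∨ c + n < a then Finsupp.single (b, c + n) (q ^ (b * n) * r) else 0 := by
  induction n with
  | zero => simp
  | succ n ih =>
    rw [pow_succ', Module.End.mul_apply, ih]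
    simp only [Nat.add_eq_zero_iff, one_ne_zero, and_false, false_or]
    split_ifs with h1 h2 h2
    · rw [modelX_single, if_pos (by omega), ← mul_assoc, ← pow_add, mul_add_one, add_comm b]
      rfl
    · rw [modelX_single, if_neg (by omega)]
    · omega
    · rw [map_zero]

variable {a}

/-- The representation of the algebra on the free module with basis the monomials. -/
def model (ha : 3 ≤ a) : QCI k a q →ₐ[k] Module.End k (ℕ × ℕ →₀ k) :=
  RingQuot.liftAlgHom k ⟨FreeAlgebra.lift k ![modelX k a q, modelY k a], by
    rintro _ _ (_ | _ | _)
    · rw [map_pow, map_zero, FreeAlgebra.lift_ι_apply]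
      refine Finsupp.lhom_ext fun p r => ?_
      exact (modelX_pow_single k a q a p.1 p.2 r).trans (if_neg (by omega))
    · rw [map_mul, map_smul, map_mul, FreeAlgebra.lift_ι_apply, FreeAlgebra.lift_ι_apply]
      refine Finsupp.lhom_ext fun p r => ?_
      obtain ⟨b, c⟩ := p
      change modelX k a q (modelY k a (Finsupp.single (b, c) r)) =
        q • modelY k a (modelX k a q (Finsupp.single (b, c) r))
      rw [modelY_single, modelX_single]
      split_ifs with h1 h2 h2
      · rw [modelX_single, modelY_single, if_pos h1, if_pos h2, Finsupp.smul_single,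
          pow_succ', mul_assoc, smul_eq_mul]
      · rw [modelX_single, if_neg h2, map_zero, smul_zero]
      · rw [modelY_single, if_neg h1, map_zero, smul_zero]
      · rw [map_zero, map_zero, smul_zero]
    · rw [map_pow, map_zero, FreeAlgebra.lift_ι_apply]
      refine Finsupp.lhom_ext fun p r => ?_
      exact (modelY_pow_single k a a p.1 p.2 r).trans (if_neg (by omega))⟩

theorem model_x (ha : 3 ≤ a) : model k q ha (x k a q) = modelX k a q := by
  refine (RingQuot.liftAlgHom_mkAlgHom_apply k _ _ _).trans ?_
  exact FreeAlgebra.lift_ι_apply _ _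

theorem model_y (ha : 3 ≤ a) : model k q ha (y k a q) = modelY k a := by
  refine (RingQuot.liftAlgHom_mkAlgHom_apply k _ _ _).trans ?_
  exact FreeAlgebra.lift_ι_apply _ _

variable (a)

/-- The monomial `y^b x^c`. -/
def mon (b c : ℕ) : QCI k a q := y k a q ^ b * x k a q ^ c

/-- The coordinates with respect to the monomials `y^b x^c`. -/
def coords (ha : 3 ≤ a) : QCI k a q →ₗ[k] (ℕ × ℕ →₀ k) :=
  LinearMap.applyₗ (Finsupp.single (0, 0) (1 : k)) ∘ₗ (model k q ha).toLinearMap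

variable {k a q}

theorem mon_eq_zero_left {b : ℕ} (c : ℕ) (hb : a ≤ b) : mon k a q b c = 0 := by
  rw [mon, ← Nat.sub_add_cancel hb, pow_add, y_pow]
  simp

theorem mon_eq_zero_right (b : ℕ) {c : ℕ} (hc : a ≤ c) : mon k a q b c = 0 := by
  rw [mon, ← Nat.sub_add_cancel hc, pow_add, x_pow]
  simp

/-- This gives linear independence of the monomials: acting on the vector of index `(0, 0)`, they
produce distinct basis vectors. -/
theorem coords_mon (ha : 3 ≤ a) {b c : ℕ} (hb : b < a) (hc : c < a) :
    coords k a q ha (mon k a q b c) = Finsupp.single (b, c) 1 := by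
  change model k q ha (mon k a q b c) (Finsupp.single (0, 0) (1 : k)) = _
  rw [mon, map_mul, map_pow, map_pow, model_x, model_y, Module.End.mul_apply, modelX_pow_single,
    if_pos (by omega), modelY_pow_single, if_pos (by omega)]
  simp

theorem mon_mul_mon (b c b' c' : ℕ) :
    mon k a q b c * mon k a q b' c' = q ^ (c * b') • mon k a q (b + b') (c + c') := by
  rw [mon, mon, mon, mul_assoc, ← mul_assoc (x k a q ^ c), x_pow_mul_y_pow, smul_mul_assoc,
    mul_smul_comm, mul_assoc, ← pow_add, ← mul_assoc, ← pow_add]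

theorem one_eq_mon : (1 : QCI k a q) = mon k a q 0 0 := by simp [mon]

theorem x_eq_mon : x k a q = mon k a q 0 1 := by simp [mon]

theorem y_eq_mon : y k a q = mon k a q 1 0 := by simp [mon]

variable (k a q) in
/-- The projection of the free algebra. -/
def ofFree : FreeAlgebra k (Fin 2) →ₐ[k] QCI k a q := RingQuot.mkAlgHom k (QCIRel k a q)

theorem ofFree_mul_mem_span_mon (f : FreeAlgebra k (Fin 2)) (m : QCI k a q)
    (hm : m ∈ Submodule.span k (Set.range fun p : ℕ × ℕ => mon k a q p.1 p.2)) :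
    ofFree k a q f * m ∈ Submodule.span k (Set.range fun p : ℕ × ℕ => mon k a q p.1 p.2) := by
  induction f using FreeAlgebra.induction generalizing m with
  | grade0 r =>
    rw [AlgHom.commutes, ← Algebra.smul_def]
    exact Submodule.smul_mem _ _ hm
  | grade1 i =>
    have key : ∀ b c : ℕ, mon k a q b c * m ∈
        Submodule.span k (Set.range fun p : ℕ × ℕ => mon k a q p.1 p.2) := by
      intro b c
      induction hm using Submodule.span_induction with
      | mem z hz =>
        obtain ⟨p, rfl⟩ := hz
        rw [mon_mul_mon]
        exact Submodule.smul_mem _ _ (Submodule.subset_span ⟨(b + p.1, c + p.2), rfl⟩)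
      | zero => simp
      | add z w _ _ hz hw => rw [mul_add]; exact add_mem hz hw
      | smul r z _ hz => rw [mul_smul_comm]; exact Submodule.smul_mem _ _ hz
    fin_cases i
    · change x k a q * m ∈ _
      rw [x_eq_mon]
      exact key 0 1
    · change y k a q * m ∈ _
      rw [y_eq_mon]
      exact key 1 0
  | mul f g hf hg =>
    rw [map_mul, mul_assoc]
    exact hf _ (hg _ hm)
  | add f g hf hg =>
    rw [map_add, add_mul]
    exact add_mem (hf _ hm) (hg _ hm)

/-- The span of the monomials contains `1` and is stable under left multiplication by the
generators. -/
theorem span_mon :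
    Submodule.span k (Set.range fun p : ℕ × ℕ => mon k a q p.1 p.2) = ⊤ := by
  refine eq_top_iff.2 fun m _ => ?_
  obtain ⟨f, hf⟩ := RingQuot.mkAlgHom_surjective k (QCIRel k a q) m
  have h := ofFree_mul_mem_span_mon f (1 : QCI k a q)
    (Submodule.subset_span ⟨(0, 0), one_eq_mon.symm⟩)
  rw [mul_one] at h
  exact hf ▸ h

/-! ### Monomials of the enveloping algebra -/

variable (k a q) in
/-- The element `y^b x^c ⊗ x^d y^e` of the enveloping algebra. -/
def emon (b c d e : ℕ) : E k a q :=
  tens k (y k a q ^ b * x k a q ^ c) (x k a q ^ d * y k a q ^ e)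

theorem emon_eq_zero {b c d e : ℕ} (h : a ≤ b ∨ a ≤ c ∨ a ≤ d ∨ a ≤ e) :
    emon k a q b c d e = 0 := by
  have hx : ∀ n, a ≤ n → x k a q ^ n = 0 := fun n hn => by
    rw [← Nat.sub_add_cancel hn, pow_add, x_pow, mul_zero]
  have hy : ∀ n, a ≤ n → y k a q ^ n = 0 := fun n hn => by
    rw [← Nat.sub_add_cancel hn, pow_add, y_pow, mul_zero]
  rw [emon]
  rcases h with h | h | h | h
  · rw [hy _ h, zero_mul, zero_tens]
  · rw [hx _ h, mul_zero, zero_tens]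
  · rw [hx _ h, zero_mul, tens_zero]
  · rw [hy _ h, mul_zero, tens_zero]

theorem emon_eq (b c d e : ℕ) :
    emon k a q b c d e = q ^ (d * e) • tens k (mon k a q b c) (mon k a q e d) := by
  rw [emon, x_pow_mul_y_pow, tens_smul_right]
  rfl

/-- A linear map on the enveloping algebra may be prescribed on the monomials. -/
theorem exists_linearMap (ha : 3 ≤ a) (hq : IsPrimitiveRoot q a) {V : Type*} [AddCommGroup V]
    [Module k V] (φ : ℕ → ℕ → ℕ → ℕ → V)
    (hφ : ∀ b c d e, a ≤ b ∨ a ≤ c ∨ a ≤ d ∨ a ≤ e → φ b c d e = 0) :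
    ∃ h : E k a q →ₗ[k] V, ∀ b c d e, h (emon k a q b c d e) = φ b c d e := by
  have hq0 : q ≠ 0 := hq.ne_zero (by omega)
  let F : QCI k a q ⊗[k] (QCI k a q)ᵐᵒᵖ →ₗ[k] V :=
    Finsupp.linearCombination k (fun p : (ℕ × ℕ) × (ℕ × ℕ) =>
      -- The right factor of `emon` is `x^d y^e`, whereas the coordinates refer to `y^e x^d`; the
      -- inverse power of `q` compensates for the reordering.
      (q ^ (p.2.2 * p.2.1))⁻¹ • φ p.1.1 p.1.2 p.2.2 p.2.1) ∘ₗ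
      (finsuppTensorFinsupp' k (ℕ × ℕ) (ℕ × ℕ)).toLinearMap ∘ₗ
      TensorProduct.map (coords k a q ha)
        (coords k a q ha ∘ₗ (MulOpposite.opLinearEquiv k).symm.toLinearMap)
  refine ⟨F, fun b c d e => ?_⟩
  by_cases h : a ≤ b ∨ a ≤ c ∨ a ≤ d ∨ a ≤ e
  · rw [emon_eq_zero h, hφ _ _ _ _ h]
    exact map_zero F
  · push Not at h
    rw [emon_eq]
    refine (map_smul F _ _).trans ?_
    have e1 : F (tens k (mon k a q b c) (mon k a q e d)) = (q ^ (d * e))⁻¹ • φ b c d e := by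
      change Finsupp.linearCombination k _ (finsuppTensorFinsupp' k _ _
        (coords k a q ha (mon k a q b c) ⊗ₜ[k] coords k a q ha (mon k a q e d))) = _
      rw [coords_mon ha h.1 h.2.1, coords_mon ha h.2.2.2 h.2.2.1,
        finsuppTensorFinsupp'_single_tmul_single, Finsupp.linearCombination_single]
      simp
    rw [e1, smul_smul, mul_inv_cancel₀ (pow_ne_zero _ hq0), one_smul]

/-! ### The filtrations by degree -/

variable (k a q) in
/-- The elements of degree at least `v`. -/
def filA (v : ℤ) : Submodule k (QCI k a q) :=
  Submodule.span k {m | ∃ b c : ℕ, v ≤ b + c ∧ m = mon k a q b c}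

variable (k a q) in
/-- The elements of the enveloping algebra of degree at least `v`. -/
def filE (v : ℤ) : Submodule k (E k a q) :=
  Submodule.span k {m | ∃ b c d e : ℕ, v ≤ b + c + d + e ∧ m = emon k a q b c d e}

theorem mon_mem_filA {v : ℤ} {b c : ℕ} (h : v ≤ b + c) : mon k a q b c ∈ filA k a q v :=
  Submodule.subset_span ⟨b, c, h, rfl⟩

theorem emon_mem_filE {v : ℤ} {b c d e : ℕ} (h : v ≤ b + c + d + e) :
    emon k a q b c d e ∈ filE k a q v :=
  Submodule.subset_span ⟨b, c, d, e, h, rfl⟩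

theorem filE_mono {v w : ℤ} (h : v ≤ w) : filE k a q w ≤ filE k a q v :=
  Submodule.span_mono fun _ ⟨b, c, d, e, hv, he⟩ => ⟨b, c, d, e, h.trans hv, he⟩

theorem filA_eq_top {v : ℤ} (h : v ≤ 0) : filA k a q v = ⊤ := by
  refine eq_top_iff.2 ((span_mon (k := k) (a := a) (q := q)).ge.trans (Submodule.span_mono ?_))
  rintro _ ⟨p, rfl⟩
  exact ⟨p.1, p.2, by omega, rfl⟩

/-- The nonzero monomial of largest degree is `y^{a-1} x^{a-1}`, of degree `2a - 2`. -/
theorem filA_eq_bot {v : ℤ} (h : 2 * a - 1 ≤ v) : filA k a q v = ⊥ := by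
  refine (Submodule.span_eq_bot).2 ?_
  rintro _ ⟨b, c, hv, rfl⟩
  by_cases hb : a ≤ b
  · exact mon_eq_zero_left c hb
  · exact mon_eq_zero_right b (by omega)

/-- Statements on the enveloping algebra compatible with linear combinations may be checked on
monomials. -/
theorem filE_induction {v : ℤ} {p : E k a q → Prop}
    (hp : ∀ b c d e : ℕ, v ≤ b + c + d + e → p (emon k a q b c d e)) (h0 : p 0)
    (hadd : ∀ m n, p m → p n → p (m + n)) (hsmul : ∀ (r : k) m, p m → p (r • m))
    {m : E k a q} (hm : m ∈ filE k a q v) : p m := by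
  induction hm using Submodule.span_induction with
  | mem z hz => obtain ⟨b, c, d, e, hv, rfl⟩ := hz; exact hp b c d e hv
  | zero => exact h0
  | add z w _ _ hz hw => exact hadd _ _ hz hw
  | smul r z _ hz => exact hsmul _ _ hz

theorem emon_mul_emon (hq0 : q ≠ 0) (b c d e b' c' d' e' : ℕ) : ∃ r : k,
    emon k a q b c d e * emon k a q b' c' d' e' =
      r • emon k a q (b + b') (c + c') (d + d') (e + e') := by
  have h := mon_mul_mon (k := k) (a := a) (q := q) b c b' c'
  have h' : mon k a q e' d' * mon k a q e d = q ^ (d' * e) • mon k a q (e + e') (d + d') := by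
    rw [mon_mul_mon, add_comm e', add_comm d']
  refine ⟨q ^ (d * e) * q ^ (d' * e') * q ^ (d' * e) * q ^ (c * b') *
    (q ^ ((d + d') * (e + e')))⁻¹, ?_⟩
  rw [emon_eq, emon_eq, emon_eq, smul_mul_assoc, mul_smul_comm, tens_mul, h, h', tens_smul_right,
    ← smul_tens, smul_smul, smul_smul, smul_smul, smul_smul, inv_mul_cancel_right₀]
  exact pow_ne_zero _ hq0

theorem filE_mul (hq0 : q ≠ 0) {v w : ℤ} {m n : E k a q} (hm : m ∈ filE k a q v)
    (hn : n ∈ filE k a q w) : m * n ∈ filE k a q (v + w) := by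
  refine filE_induction (p := fun m => m * n ∈ filE k a q (v + w)) ?_ (by simp)
    (fun _ _ h h' => by rw [add_mul]; exact add_mem h h')
    (fun _ _ h => by rw [smul_mul_assoc]; exact Submodule.smul_mem _ _ h) hm
  intro b c d e hv
  refine filE_induction (p := fun n => emon k a q b c d e * n ∈ filE k a q (v + w)) ?_ (by simp)
    (fun _ _ h h' => by rw [mul_add]; exact add_mem h h')
    (fun _ _ h => by rw [mul_smul_comm]; exact Submodule.smul_mem _ _ h) hn
  intro b' c' d' e' hw
  obtain ⟨r, hr⟩ := emon_mul_emon (k := k) (a := a) hq0 b c d e b' c' d' e'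
  rw [hr]
  exact Submodule.smul_mem _ _ (emon_mem_filE (by push_cast; linarith))

theorem emon_smul_mon (b c d e b' c' : ℕ) : ∃ r : k,
    emon k a q b c d e • mon k a q b' c' = r • mon k a q (b + b' + e) (c + c' + d) := by
  rw [emon_eq, smul_assoc, tens_smul, mon_mul_mon, smul_mul_assoc, mon_mul_mon, smul_smul,
    smul_smul]
  exact ⟨_, rfl⟩

theorem smul_mem_filA {v w : ℤ} {m : E k a q} {n : QCI k a q} (hm : m ∈ filE k a q v)
    (hn : n ∈ filA k a q w) : m • n ∈ filA k a q (v + w) := by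
  refine filE_induction (p := fun m => m • n ∈ filA k a q (v + w)) ?_ (by simp)
    (fun _ _ h h' => by rw [add_smul]; exact add_mem h h')
    (fun _ _ h => by rw [smul_assoc]; exact Submodule.smul_mem _ _ h) hm
  intro b c d e hv
  induction hn using Submodule.span_induction with
  | mem z hz =>
    obtain ⟨b', c', hw, rfl⟩ := hz
    obtain ⟨r, hr⟩ := emon_smul_mon (k := k) (a := a) (q := q) b c d e b' c'
    rw [hr]
    exact Submodule.smul_mem _ _ (mon_mem_filA (by push_cast; linarith))
  | zero => simp
  | add z w _ _ hz hw => rw [smul_add]; exact add_mem hz hw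
  | smul r z _ hz => rw [smul_comm]; exact Submodule.smul_mem _ _ hz

theorem tens_mem_filE (hq0 : q ≠ 0) {v w : ℤ} {m n : QCI k a q} (hm : m ∈ filA k a q v)
    (hn : n ∈ filA k a q w) : tens k m n ∈ filE k a q (v + w) := by
  have hadd : ∀ m m' n : QCI k a q, tens k (m + m') n = tens k m n + tens k m' n :=
    fun m m' n => TensorProduct.add_tmul _ _ _
  have hadd' : ∀ m n n' : QCI k a q, tens k m (n + n') = tens k m n + tens k m n' :=
    fun m n n' => TensorProduct.tmul_add _ _ _
  induction hm using Submodule.span_induction with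
  | mem z hz =>
    obtain ⟨b, c, hv, rfl⟩ := hz
    induction hn using Submodule.span_induction with
    | mem z hz =>
      obtain ⟨e, d, hw, rfl⟩ := hz
      have h : tens k (mon k a q b c) (mon k a q e d) =
          (q ^ (d * e))⁻¹ • emon k a q b c d e := by
        rw [emon_eq, smul_smul, inv_mul_cancel₀ (pow_ne_zero _ hq0), one_smul]
      rw [h]
      exact Submodule.smul_mem _ _ (emon_mem_filE (by linarith))
    | zero => rw [tens_zero]; exact zero_mem _
    | add z w _ _ hz hw => rw [hadd']; exact add_mem hz hw
    | smul r z _ hz => rw [tens_smul_right]; exact Submodule.smul_mem _ _ hz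
  | zero => rw [zero_tens]; exact zero_mem _
  | add z w _ _ hz hw => rw [hadd]; exact add_mem hz hw
  | smul r z _ hz => rw [← smul_tens]; exact Submodule.smul_mem _ _ hz

theorem filE_eq_top (hq0 : q ≠ 0) {v : ℤ} (h : v ≤ 0) : filE k a q v = ⊤ := by
  refine eq_top_iff.2 fun m _ => ?_
  refine env_induction k (C := fun m => m ∈ filE k a q v) m (zero_mem _) (fun u w => ?_)
    fun _ _ h h' => add_mem h h'
  refine filE_mono h (tens_mem_filE hq0 (v := 0) (w := 0) ?_ ?_) <;>
  · rw [filA_eq_top le_rfl]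
    trivial

end Model
end HH
end

/-! ### Homotopies for the periodic resolution of a truncated polynomial ring in one variable. -/

noncomputable section

namespace HH

section OneVariable

variable {k V : Type*} [Field k] [AddCommGroup V] [Module k V] (a : ℕ) (l : k) (F : ℕ → ℕ → V)

/-- The values of the first contracting homotopy of the resolution of `k[t]/(t^a)`. -/
def homotopyVal (c d : ℕ) : V :=
  if c < a then ∑ j ∈ Finset.range c, l ^ (c - 1 - j) • F j (d + (c - 1 - j)) else 0

variable {a l F}

theorem sum_homotopyVal_succ (c d : ℕ) :
    ∑ j ∈ Finset.range (c + 1), l ^ (c + 1 - 1 - j) • F j (d + (c + 1 - 1 - j)) =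
      l • ∑ j ∈ Finset.range c, l ^ (c - 1 - j) • F j (d + 1 + (c - 1 - j)) + F c d := by
  rw [Finset.sum_range_succ, Finset.smul_sum]
  congr 1
  · refine Finset.sum_congr rfl fun j hj => ?_
    have := Finset.mem_range.1 hj
    rw [smul_smul, ← pow_succ', show c - 1 - j + 1 = c + 1 - 1 - j by omega,
      show d + 1 + (c - 1 - j) = d + (c + 1 - 1 - j) by omega]
  · simp

/-- Read `F c d` as `t^c ⊗ t^d`. The bracket is the homotopy applied to the product with `τ`, and
the right side is a multiple of `γ`. Below `c = a - 1` the two sums differ by one term, `F c d`; at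
`c = a - 1` the second value is zero by convention, as `t^a = 0`, and the whole sum `γ` survives. -/
theorem add_homotopyVal (hF : ∀ c d, a ≤ c ∨ a ≤ d → F c d = 0) (ha : 3 ≤ a) (c d : ℕ) :
    F c d + (l • homotopyVal a l F c (d + 1) - homotopyVal a l F (c + 1) d) =
      if c = a - 1 then ∑ j ∈ Finset.range a, l ^ j • F (0 + (a - 1 - j)) (d + j) else 0 := by
  have h := sum_homotopyVal_succ (l := l) (F := F) c d
  rcases lt_trichotomy c (a - 1) with hc | hc | hc
  · rw [homotopyVal, homotopyVal, if_pos (by omega), if_pos (by omega), if_neg (by omega), h]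
    abel
  · rw [homotopyVal, homotopyVal, if_pos (by omega), if_neg (by omega), if_pos hc, sub_zero,
      add_comm, ← h, show c + 1 = a by omega, ← Finset.sum_range_reflect]
    refine Finset.sum_congr rfl fun j hj => ?_
    have := Finset.mem_range.1 hj
    rw [show a - 1 - (a - 1 - j) = j by omega, zero_add]
  · rw [homotopyVal, homotopyVal, if_neg (by omega), if_neg (by omega), if_neg (by omega),
      hF _ _ (Or.inl (by omega))]
    simp

/-- The homotopy for `γ` sends `t^{a-1} ⊗ t^d` to `1 ⊗ t^d` and kills the other monomials. Applied
to a product with `γ`, it keeps only the summand `j = c`. -/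
theorem sum_ite_eq (hF : ∀ c d, a ≤ c ∨ a ≤ d → F c d = 0) (ha : 3 ≤ a) (c d : ℕ) :
    ∑ j ∈ Finset.range a, l ^ j •
      (if c + (a - 1 - j) = a - 1 then F 0 (d + j) else 0) = l ^ c • F 0 (d + c) := by
  by_cases hc : c < a
  · rw [Finset.sum_eq_single c]
    · rw [if_pos (by omega)]
    · intro j hj hjc
      have := Finset.mem_range.1 hj
      rw [if_neg (by omega), smul_zero]
    · intro h
      exact absurd (Finset.mem_range.2 hc) h
  · rw [hF 0 _ (Or.inr (by omega)), smul_zero]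
    refine Finset.sum_eq_zero fun j hj => ?_
    have := Finset.mem_range.1 hj
    rw [if_neg (by omega), smul_zero]

end OneVariable

/-! ### Exactness in the `x`-direction, and in the `y`-direction modulo `τ_x`. -/

section Rows

variable {k : Type u} [Field k] {a : ℕ} {q : k}

theorem emon_mul_xx (b c d e i j : ℕ) :
    emon k a q b c d e * xx k a q i j = emon k a q b (c + i) (d + j) e := by
  rw [emon, xx, tens_mul, emon, mul_assoc, ← pow_add, ← mul_assoc, ← pow_add, add_comm j]

/-- With no `x` in the left factor, only the passage of `y^j` across `x^d` on the right contributes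
a power of `q`. -/
theorem emon_mul_yy (hq0 : q ≠ 0) (b d e i j : ℕ) :
    emon k a q b 0 d e * yy k a q i j =
      ((q ^ d)⁻¹) ^ j • emon k a q (b + i) 0 d (e + j) := by
  have h : y k a q ^ j * x k a q ^ d = ((q ^ d)⁻¹) ^ j • (x k a q ^ d * y k a q ^ j) := by
    rw [x_pow_mul_y_pow, smul_smul, pow_mul, ← mul_pow, inv_mul_cancel₀ (pow_ne_zero _ hq0),
      one_pow, one_smul]
  rw [emon, yy, tens_mul, ← mul_assoc (y k a q ^ j), h, smul_mul_assoc, tens_smul_right, emon,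
    pow_zero, mul_one, mul_one, ← pow_add, mul_assoc, ← pow_add, add_comm j]

theorem emon_mul_tauX (s b c d e : ℕ) : emon k a q b c d e * tauX k a q s =
    q ^ s • emon k a q b c (d + 1) e - emon k a q b (c + 1) d e := by
  rw [tauX, mul_sub, mul_smul_comm, emon_mul_xx, emon_mul_xx]
  rfl

theorem emon_mul_gammaX (s b c d e : ℕ) : emon k a q b c d e * gammaX k a q s =
    ∑ j ∈ Finset.range a, (q ^ s) ^ j • emon k a q b (c + (a - 1 - j)) (d + j) e := by
  rw [gammaX, Finset.mul_sum]
  refine Finset.sum_congr rfl fun j _ => ?_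
  rw [mul_smul_comm, emon_mul_xx, ← pow_mul, mul_comm s]

/-- For each fixed `d` this is the one-variable situation with parameter `q^{-d}`. -/
theorem emon_mul_tauY (hq0 : q ≠ 0) (b d e : ℕ) : emon k a q b 0 d e * tauY k a q 0 =
    (q ^ d)⁻¹ • emon k a q b 0 d (e + 1) - emon k a q (b + 1) 0 d e := by
  rw [tauY, mul_sub, mul_smul_comm, emon_mul_yy hq0, emon_mul_yy hq0]
  simp

theorem emon_mul_gammaY (hq0 : q ≠ 0) (b d e : ℕ) : emon k a q b 0 d e * gammaY k a q 0 =
    ∑ j ∈ Finset.range a, ((q ^ d)⁻¹) ^ j • emon k a q (b + (a - 1 - j)) 0 d (e + j) := by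
  rw [gammaY, Finset.mul_sum, ← Finset.sum_range_reflect]
  refine Finset.sum_congr rfl fun j hj => ?_
  have := Finset.mem_range.1 hj
  rw [mul_smul_comm, emon_mul_yy hq0, mul_zero, pow_zero, one_smul,
    show a - 1 - (a - 1 - j) = j by omega]

variable (k a q) in
/-- The multiples `w * m`, where `w` has degree at least `v`. -/
def filMul (v : ℤ) (m : E k a q) : Submodule k (E k a q) :=
  (filE k a q v).map (LinearMap.mulRight k m)

theorem mem_filMul {v : ℤ} {m e : E k a q} :
    e ∈ filMul k a q v m ↔ ∃ w ∈ filE k a q v, w * m = e := Iff.rfl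

theorem filMul_mono {v w : ℤ} (h : v ≤ w) (m : E k a q) :
    filMul k a q w m ≤ filMul k a q v m :=
  Submodule.map_mono (filE_mono h)

variable (k a q) in
/-- The span of the monomials `y^b ⊗ x^d y^e` of degree at least `v`. -/
def filN (v : ℤ) : Submodule k (E k a q) :=
  Submodule.span k {m | ∃ b d e : ℕ, v ≤ b + d + e ∧ m = emon k a q b 0 d e}

theorem exists_tauX_homotopy (ha : 3 ≤ a) (hq : IsPrimitiveRoot q a) (s : ℕ) :
    ∃ h : E k a q →ₗ[k] E k a q, ∀ v : ℤ, ∀ e ∈ filE k a q v,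
      e + h (e * tauX k a q s) ∈ filMul k a q (v - (a - 1)) (gammaX k a q s) := by
  obtain ⟨h, hh⟩ := exists_linearMap ha hq
    (fun b c d e => homotopyVal a (q ^ s) (fun c d => emon k a q b c d e) c d) (by
      intro b c d e hz
      rw [homotopyVal]
      split_ifs with hc
      · refine Finset.sum_eq_zero fun j _ => ?_
        rw [emon_eq_zero (by omega), smul_zero]
      · rfl)
  refine ⟨h, fun v e he => filE_induction
    (p := fun e => e + h (e * tauX k a q s) ∈ filMul k a q (v - (a - 1)) (gammaX k a q s))
    ?_ (by simp) ?_ ?_ he⟩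
  · intro b c d e hv
    rw [emon_mul_tauX, map_sub, map_smul, hh, hh, add_homotopyVal (F := fun c d =>
      emon k a q b c d e) (fun c d h => emon_eq_zero (by omega)) ha]
    split_ifs with hc
    · exact ⟨emon k a q b 0 d e, emon_mem_filE (by omega), emon_mul_gammaX _ _ _ _ _⟩
    · exact zero_mem _
  · intro m n hm hn
    rw [add_mul, map_add, add_add_add_comm]
    exact add_mem hm hn
  · intro r m hm
    rw [smul_mul_assoc, map_smul, ← smul_add]
    exact Submodule.smul_mem _ _ hm

/-- Modulo left multiples of `τ_x(s)`, a factor `x` moves from the left of the tensor sign to its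
right at the cost of `q^s`. The factors are moved one at a time, without loss of degree. -/
theorem sub_emon_mem_filMul_tauX (s b c d e : ℕ) :
    emon k a q b c d e - (q ^ s) ^ c • emon k a q b 0 (d + c) e ∈
      filMul k a q (b + c + d + e - 1) (tauX k a q s) := by
  induction c generalizing d with
  | zero => simp
  | succ c ih =>
    have h := Submodule.smul_mem _ (q ^ s) (ih (d + 1))
    rw [smul_sub, smul_smul, ← pow_succ', show d + 1 + c = d + (c + 1) by ring] at h
    have h' : q ^ s • emon k a q b c (d + 1) e - emon k a q b (c + 1) d e ∈
        filMul k a q (b + c + d + e) (tauX k a q s) :=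
      ⟨_, emon_mem_filE le_rfl, emon_mul_tauX s b c d e⟩
    have h2 := sub_mem
      (filMul_mono (v := b + (c + 1 : ℕ) + d + e - 1) (by push_cast; linarith) _ h)
      (filMul_mono (v := b + (c + 1 : ℕ) + d + e - 1) (by push_cast; linarith) _ h')
    rwa [sub_sub_sub_cancel_left] at h2

theorem sub_emon_mem_filMul_tauY (hq0 : q ≠ 0) (b d e : ℕ) :
    emon k a q b 0 d e - ((q ^ d)⁻¹) ^ b • emon k a q 0 0 d (e + b) ∈
      filMul k a q (b + d + e - 1) (tauY k a q 0) := by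
  induction b generalizing e with
  | zero => simp
  | succ b ih =>
    have h := Submodule.smul_mem _ (q ^ d)⁻¹ (ih (e + 1))
    rw [smul_sub, smul_smul, ← pow_succ', show e + 1 + b = e + (b + 1) by ring] at h
    have h' : (q ^ d)⁻¹ • emon k a q b 0 d (e + 1) - emon k a q (b + 1) 0 d e ∈
        filMul k a q (b + d + e) (tauY k a q 0) :=
      ⟨_, emon_mem_filE (by simp), emon_mul_tauY hq0 b d e⟩
    have h2 := sub_mem
      (filMul_mono (v := (b + 1 : ℕ) + d + e - 1) (by push_cast; linarith) _ h)
      (filMul_mono (v := (b + 1 : ℕ) + d + e - 1) (by push_cast; linarith) _ h')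
    rwa [sub_sub_sub_cancel_left] at h2

/-- The projection to the normal form modulo left multiples of `τ_x(s)`, with the homotopy of
`γ_x(s)`. -/
theorem exists_normalForm (ha : 3 ≤ a) (hq : IsPrimitiveRoot q a) (s : ℕ) :
    ∃ π h : E k a q →ₗ[k] E k a q, (∀ e, π (e * tauX k a q s) = 0) ∧
      (∀ e, h (e * gammaX k a q s) = π e) ∧ (∀ v, ∀ e ∈ filN k a q v, π e = e) ∧
      (∀ v, ∀ e ∈ filE k a q v, π e ∈ filN k a q v) ∧
      ∀ v, ∀ e ∈ filE k a q v, e - π e ∈ filMul k a q (v - 1) (tauX k a q s) := by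
  have hq0 : q ≠ 0 := hq.ne_zero (by omega)
  -- All factors `x` are moved to the right of the tensor sign.
  obtain ⟨π, hπ⟩ := exists_linearMap ha hq
    (fun b c d e => (q ^ s) ^ c • emon k a q b 0 (d + c) e) (by
      intro b c d e hz
      rw [emon_eq_zero (by omega), smul_zero])
  -- This `h` reads off the part with left `x`-exponent `a - 1`.
  obtain ⟨h, hh⟩ := exists_linearMap ha hq
    (fun b c d e => if c = a - 1 then emon k a q b 0 d e else 0) (by
      intro b c d e hz
      split_ifs
      · rw [emon_eq_zero (by omega)]
      · rfl)
  have htop : ∀ e, e ∈ filE k a q 0 := fun e => by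
    rw [filE_eq_top hq0 le_rfl]
    trivial
  refine ⟨π, h, fun e => ?_, fun e => ?_, fun v e he => ?_, fun v e he => ?_, fun v e he => ?_⟩
  · refine filE_induction (p := fun e => π (e * tauX k a q s) = 0) ?_ (by simp)
      (fun m n hm hn => by rw [add_mul, map_add, hm, hn, add_zero])
      (fun r m hm => by rw [smul_mul_assoc, map_smul, hm, smul_zero]) (htop e)
    intro b c d e _
    rw [emon_mul_tauX, map_sub, map_smul, hπ, hπ, smul_smul, ← pow_succ',
      show d + 1 + c = d + (c + 1) by ring, sub_self]
  · refine filE_induction (p := fun e => h (e * gammaX k a q s) = π e) ?_ (by simp)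
      (fun m n hm hn => by rw [add_mul, map_add, hm, hn, map_add])
      (fun r m hm => by rw [smul_mul_assoc, map_smul, hm, map_smul]) (htop e)
    intro b c d e _
    rw [emon_mul_gammaX, map_sum, hπ, ← sum_ite_eq (F := fun c d => emon k a q b c d e)
      (fun c d h => emon_eq_zero (by omega)) ha]
    refine Finset.sum_congr rfl fun j _ => ?_
    rw [map_smul, hh]
  · induction he using Submodule.span_induction with
    | mem z hz =>
      obtain ⟨b, d, e, _, rfl⟩ := hz
      rw [hπ]
      simp
    | zero => simp
    | add z w _ _ hz hw => rw [map_add, hz, hw]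
    | smul r z _ hz => rw [map_smul, hz]
  · refine filE_induction (p := fun e => π e ∈ filN k a q v) ?_ (by simp)
      (fun m n hm hn => by rw [map_add]; exact add_mem hm hn)
      (fun r m hm => by rw [map_smul]; exact Submodule.smul_mem _ _ hm) he
    intro b c d e hv
    rw [hπ]
    exact Submodule.smul_mem _ _ (Submodule.subset_span ⟨b, d + c, e, by push_cast; linarith, rfl⟩)
  · refine filE_induction (p := fun e => e - π e ∈ filMul k a q (v - 1) (tauX k a q s)) ?_
      (by simp) (fun m n hm hn => by rw [map_add, add_sub_add_comm]; exact add_mem hm hn)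
      (fun r m hm => by rw [map_smul, ← smul_sub]; exact Submodule.smul_mem _ _ hm) he
    intro b c d e hv
    rw [hπ]
    exact filMul_mono (by linarith) _ (sub_emon_mem_filMul_tauX s b c d e)

/-- Exactness of the rows at `τ_x(s)`. -/
theorem mem_filMul_gammaX (ha : 3 ≤ a) (hq : IsPrimitiveRoot q a) {s : ℕ} {v : ℤ} {e : E k a q}
    (he : e ∈ filE k a q v) (h0 : e * tauX k a q s = 0) :
    e ∈ filMul k a q (v - (a - 1)) (gammaX k a q s) := by
  obtain ⟨h, hh⟩ := exists_tauX_homotopy (k := k) ha hq s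
  have := hh v e he
  rwa [h0, map_zero, add_zero] at this

/-- Exactness of the rows at `γ_x(s)`. -/
theorem mem_filMul_tauX (ha : 3 ≤ a) (hq : IsPrimitiveRoot q a) {s : ℕ} {v : ℤ} {e : E k a q}
    (he : e ∈ filE k a q v) (h0 : e * gammaX k a q s = 0) :
    e ∈ filMul k a q (v - 1) (tauX k a q s) := by
  obtain ⟨π, h, _, h2, _, _, h5⟩ := exists_normalForm (k := k) ha hq s
  have := h5 v e he
  rwa [← h2, h0, map_zero, sub_zero] at this

/-- Normal forms are stable under the column maps, so the column modulo `τ_x` can be computed on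
them. -/
theorem mul_tauY_mem_filN (hq0 : q ≠ 0) {v : ℤ} {e : E k a q} (he : e ∈ filN k a q v) :
    e * tauY k a q 0 ∈ filN k a q v := by
  induction he using Submodule.span_induction with
  | mem z hz =>
    obtain ⟨b, d, e, hv, rfl⟩ := hz
    rw [emon_mul_tauY hq0]
    exact sub_mem (Submodule.smul_mem _ _ (Submodule.subset_span
      ⟨b, d, e + 1, by push_cast; linarith, rfl⟩))
      (Submodule.subset_span ⟨b + 1, d, e, by push_cast; linarith, rfl⟩)
  | zero => simp
  | add z w _ _ hz hw => rw [add_mul]; exact add_mem hz hw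
  | smul r z _ hz => rw [smul_mul_assoc]; exact Submodule.smul_mem _ _ hz

theorem mul_gammaY_mem_filN (hq0 : q ≠ 0) {v : ℤ} {e : E k a q} (he : e ∈ filN k a q v) :
    e * gammaY k a q 0 ∈ filN k a q v := by
  induction he using Submodule.span_induction with
  | mem z hz =>
    obtain ⟨b, d, e, hv, rfl⟩ := hz
    rw [emon_mul_gammaY hq0]
    exact sum_mem fun j _ => Submodule.smul_mem _ _ (Submodule.subset_span
      ⟨_, d, e + j, by push_cast; linarith, rfl⟩)
  | zero => simp
  | add z w _ _ hz hw => rw [add_mul]; exact add_mem hz hw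
  | smul r z _ hz => rw [smul_mul_assoc]; exact Submodule.smul_mem _ _ hz

/-- On normal forms the column splits according to the exponent `d` of `x`, and the one-variable
homotopy applies with the parameter `q^{-d}`. -/
theorem mem_filMul_gammaY (ha : 3 ≤ a) (hq : IsPrimitiveRoot q a) {v : ℤ} {e : E k a q}
    (he : e ∈ filN k a q v) (h0 : e * tauY k a q 0 = 0) :
    e ∈ filMul k a q (v - (a - 1)) (gammaY k a q 0) := by
  have hq0 : q ≠ 0 := hq.ne_zero (by omega)
  obtain ⟨h, hh⟩ := exists_linearMap ha hq
    (fun b c d e => homotopyVal a (q ^ d)⁻¹ (fun b e => emon k a q b c d e) b e) (by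
      intro b c d e hz
      rw [homotopyVal]
      split_ifs with hc
      · refine Finset.sum_eq_zero fun j _ => ?_
        rw [emon_eq_zero (by omega), smul_zero]
      · rfl)
  have key : e + h (e * tauY k a q 0) ∈ filMul k a q (v - (a - 1)) (gammaY k a q 0) := by
    clear h0
    induction he using Submodule.span_induction with
    | mem z hz =>
      obtain ⟨b, d, e, hv, rfl⟩ := hz
      rw [emon_mul_tauY hq0, map_sub, map_smul, hh, hh, add_homotopyVal (F := fun b e =>
        emon k a q b 0 d e) (fun c d h => emon_eq_zero (by omega)) ha]
      split_ifs with hc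
      · exact ⟨emon k a q 0 0 d e, emon_mem_filE (by omega), emon_mul_gammaY hq0 _ _ _⟩
      · exact zero_mem _
    | zero => simp
    | add z w _ _ hz hw =>
      rw [add_mul, map_add, add_add_add_comm]
      exact add_mem hz hw
    | smul r z _ hz =>
      rw [smul_mul_assoc, map_smul, ← smul_add]
      exact Submodule.smul_mem _ _ hz
  rwa [h0, map_zero, add_zero] at key

theorem mem_filMul_tauY (ha : 3 ≤ a) (hq : IsPrimitiveRoot q a) {v : ℤ} {e : E k a q}
    (he : e ∈ filN k a q v) (h0 : e * gammaY k a q 0 = 0) :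
    e ∈ filMul k a q (v - 1) (tauY k a q 0) := by
  have hq0 : q ≠ 0 := hq.ne_zero (by omega)
  obtain ⟨h, hh⟩ := exists_linearMap ha hq
    (fun b c d e => if b = a - 1 then emon k a q 0 c d e else 0) (by
      intro b c d e hz
      split_ifs
      · rw [emon_eq_zero (by omega)]
      · rfl)
  have key : e - h (e * gammaY k a q 0) ∈ filMul k a q (v - 1) (tauY k a q 0) := by
    clear h0
    induction he using Submodule.span_induction with
    | mem z hz =>
      obtain ⟨b, d, e, hv, rfl⟩ := hz
      have : h (emon k a q b 0 d e * gammaY k a q 0) =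
          ((q ^ d)⁻¹) ^ b • emon k a q 0 0 d (e + b) := by
        rw [emon_mul_gammaY hq0, map_sum, ← sum_ite_eq (F := fun b e => emon k a q b 0 d e)
          (fun c d h => emon_eq_zero (by omega)) ha]
        refine Finset.sum_congr rfl fun j _ => ?_
        rw [map_smul, hh]
      rw [this]
      exact filMul_mono (by linarith) _ (sub_emon_mem_filMul_tauY hq0 b d e)
    | zero => simp
    | add z w _ _ hz hw =>
      rw [add_mul, map_add, add_sub_add_comm]
      exact add_mem hz hw
    | smul r z _ hz =>
      rw [smul_mul_assoc, map_smul, ← smul_sub]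
      exact Submodule.smul_mem _ _ hz
  rwa [h0, map_zero, sub_zero] at key

/-- Exactness of the first column at `τ_y(0)`, modulo `τ_x`. -/
theorem exists_gammaY_add_tauX (ha : 3 ≤ a) (hq : IsPrimitiveRoot q a) {v : ℤ} {e w : E k a q}
    (he : e ∈ filE k a q v) (h0 : e * tauY k a q 0 = w * tauX k a q 0) :
    ∃ w₀ ∈ filE k a q (v - (a - 1)), ∃ w₁ ∈ filE k a q (v - 1),
      w₀ * gammaY k a q 0 + w₁ * tauX k a q 1 = e := by
  have hq0 : q ≠ 0 := hq.ne_zero (by omega)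
  obtain ⟨π, -, -, -, -, h4, h5⟩ := exists_normalForm (k := k) ha hq 1
  obtain ⟨π', -, h1', -, h3', -, -⟩ := exists_normalForm (k := k) ha hq 0
  obtain ⟨w₁, hw₁, h⟩ := mem_filMul.1 (h5 v e he)
  -- Replacing `e` by its normal form modulo `τ_x(1)` keeps the hypothesis, by the commutation of
  -- `τ_y` with `τ_x`.
  have hn : π e * tauY k a q 0 = (w - w₁ * tauY k a q 1) * tauX k a q 0 := by
    have : π e = e - w₁ * tauX k a q 1 := by rw [h]; abel
    rw [this, sub_mul, h0, mul_assoc, ← tauY_mul_tauX, sub_mul, mul_assoc]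
  -- The product is a normal form and a left multiple of `τ_x(0)`; the projection `π'` fixes the
  -- former and kills the latter.
  have hz : π e * tauY k a q 0 = 0 := by
    rw [← h3' v _ (mul_tauY_mem_filN hq0 (h4 v e he)), hn, h1']
  obtain ⟨w₀, hw₀, h'⟩ := mem_filMul.1 (mem_filMul_gammaY ha hq (h4 v e he) hz)
  exact ⟨w₀, hw₀, w₁, hw₁, by rw [h', h]; abel⟩

/-- Exactness of the first column at `γ_y(0)`, modulo `τ_x`. -/
theorem exists_tauY_add_tauX (ha : 3 ≤ a) (hq : IsPrimitiveRoot q a) {v : ℤ} {e w : E k a q}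
    (he : e ∈ filE k a q v) (h0 : e * gammaY k a q 0 = w * tauX k a q 1) :
    ∃ w₀ ∈ filE k a q (v - 1), ∃ w₁ ∈ filE k a q (v - 1),
      w₀ * tauY k a q 0 + w₁ * tauX k a q 0 = e := by
  have hq0 : q ≠ 0 := hq.ne_zero (by omega)
  obtain ⟨π, -, -, -, -, h4, h5⟩ := exists_normalForm (k := k) ha hq 0
  obtain ⟨π', -, h1', -, h3', -, -⟩ := exists_normalForm (k := k) ha hq 1
  obtain ⟨w₁, hw₁, h⟩ := mem_filMul.1 (h5 v e he)
  have hn : π e * gammaY k a q 0 = (w - w₁ * gammaY k a q 1) * tauX k a q 1 := by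
    have : π e = e - w₁ * tauX k a q 0 := by rw [h]; abel
    rw [this, sub_mul, h0, mul_assoc, tauX_mul_gammaY hq, sub_mul, mul_assoc]
  have hz : π e * gammaY k a q 0 = 0 := by
    rw [← h3' v _ (mul_gammaY_mem_filN hq0 (h4 v e he)), hn, h1']
  obtain ⟨w₀, hw₀, h'⟩ := mem_filMul.1 (mem_filMul_tauY ha hq (h4 v e he) hz)
  exact ⟨w₀, hw₀, w₁, hw₁, by rw [h', h]; abel⟩

/-- Modulo `τ_x(0)` and `τ_y(0)` all factors move to the right of the tensor sign. The augmentation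
then sees exactly `m`, so on its kernel `m` vanishes. -/
theorem exists_tens_one_sub_mem (hq0 : q ≠ 0) {v : ℤ} {e : E k a q} (he : e ∈ filE k a q v) :
    ∃ m : QCI k a q, e - tens k 1 m ∈
      filMul k a q (v - 1) (tauY k a q 0) ⊔ filMul k a q (v - 1) (tauX k a q 0) := by
  refine filE_induction (p := fun e => ∃ m : QCI k a q, e - tens k 1 m ∈
      filMul k a q (v - 1) (tauY k a q 0) ⊔ filMul k a q (v - 1) (tauX k a q 0))
    ?_ ⟨0, by simp [tens_zero]⟩ ?_ ?_ he
  · intro b c d e hv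
    refine ⟨((q ^ (d + c))⁻¹) ^ b • (x k a q ^ (d + c) * y k a q ^ (e + b)), ?_⟩
    have h1 := sub_emon_mem_filMul_tauX (k := k) (a := a) (q := q) 0 b c d e
    have h2 := sub_emon_mem_filMul_tauY (k := k) (a := a) hq0 b (d + c) e
    rw [pow_zero, one_pow, one_smul] at h1
    have h3 : emon k a q 0 0 (d + c) (e + b) =
        tens k 1 (x k a q ^ (d + c) * y k a q ^ (e + b)) := by simp [emon]
    rw [tens_smul_right, ← h3]
    rw [← sub_add_sub_cancel _ (emon k a q b 0 (d + c) e)]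
    exact add_mem
      (Submodule.mem_sup_right (filMul_mono (by linarith) _ h1))
      (Submodule.mem_sup_left (filMul_mono (by push_cast; linarith) _ h2))
  · rintro m n ⟨m', hm⟩ ⟨n', hn⟩
    refine ⟨m' + n', ?_⟩
    have : tens k 1 (m' + n') = tens k 1 m' + tens k 1 n' := TensorProduct.tmul_add _ _ _
    rw [this, add_sub_add_comm]
    exact add_mem hm hn
  · rintro r m ⟨m', hm⟩
    refine ⟨r • m', ?_⟩
    rw [tens_smul_right, ← smul_sub]
    exact Submodule.smul_mem _ _ hm

/-- The kernel of the augmentation. -/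
theorem exists_tauY_add_tauX_of_smul_one (hq0 : q ≠ 0) {v : ℤ} {e : E k a q}
    (he : e ∈ filE k a q v) (h0 : e • (1 : QCI k a q) = 0) :
    ∃ w₀ ∈ filE k a q (v - 1), ∃ w₁ ∈ filE k a q (v - 1),
      w₀ * tauY k a q 0 + w₁ * tauX k a q 0 = e := by
  obtain ⟨m, hm⟩ := exists_tens_one_sub_mem hq0 he
  obtain ⟨_, ⟨w₀, hw₀, rfl⟩, _, ⟨w₁, hw₁, rfl⟩, h⟩ := Submodule.mem_sup.1 hm
  change w₀ * tauY k a q 0 + w₁ * tauX k a q 0 = _ at h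
  have h1 : (e - tens k 1 m) • (1 : QCI k a q) = 0 := by
    rw [← h, add_smul, mul_smul, mul_smul, tauY_smul, tauX_smul]
    simp
  rw [sub_smul, h0, tens_smul, zero_sub, neg_eq_zero, one_mul, one_mul] at h1
  exact ⟨w₀, hw₀, w₁, hw₁, by rw [h, h1, tens_zero, sub_zero]⟩

end Rows
end HH
end

/-! ### Strict exactness of the bimodule resolution. -/

noncomputable section

namespace HH

section Exactness

variable {k : Type u} [Field k] {a : ℕ} {q : k}

/-- The internal degree of the part of a generator in one of the two variables. -/
def wt (a i : ℕ) : ℤ := a * (i / 2 : ℕ) + (i % 2 : ℕ)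

theorem wt_succ_of_even {i : ℕ} (h : Even i) : wt a (i + 1) = wt a i + 1 := by
  obtain ⟨j, rfl⟩ := h
  rw [wt, wt, show (j + j + 1) / 2 = j by omega, show (j + j) / 2 = j by omega,
    show (j + j + 1) % 2 = 1 by omega, show (j + j) % 2 = 0 by omega]
  push_cast
  ring

theorem wt_succ_of_odd {i : ℕ} (h : ¬ Even i) : wt a (i + 1) = wt a i + (a - 1) := by
  obtain ⟨j, rfl⟩ := Nat.not_even_iff_odd.1 h
  rw [wt, wt, show (2 * j + 1 + 1) / 2 = j + 1 by omega, show (2 * j + 1) / 2 = j by omega,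
    show (2 * j + 1 + 1) % 2 = 0 by omega, show (2 * j + 1) % 2 = 1 by omega]
  push_cast
  ring

theorem wt_nonneg (i : ℕ) : 0 ≤ wt a i := by
  rw [wt]
  positivity

/-! ### The coefficients of the differential -/

variable (k a q) in
/-- The coefficient of `f_{i-1}` in the differential of the generator of bidegree `(i, j)`. -/
def coefX (i j : ℕ) : E k a q := if Even i then gammaX k a q (j % 2) else tauX k a q (j % 2)

variable (k a q) in
/-- The coefficient of `f_i` in the differential of the generator of bidegree `(i, j)`. -/
def coefY (i j : ℕ) : E k a q :=
  if Even j then (if Even i then gammaY k a q 0 else -gammaY k a q 1)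
  else if Even i then tauY k a q 0 else -tauY k a q 1

/-- The complex is the total complex of a double complex in which the generator has bidegree `(i, n
+ 1 - i)`; the parities of these two numbers determine the coefficients. -/
theorem dgen_eq (n i : ℕ) (hi : i ≤ n + 1) : dgen k a q n (i : ℕ) =
    coefY k a q i (n + 1 - i) • gen k a q n i + coefX k a q i (n + 1 - i) • gen k a q n (i - 1) := by
  have hc : Even (i : ℤ) ↔ Even i := Int.even_coe_nat i
  rw [dgen, coefY, coefX]
  simp only [hc]
  by_cases hn : Even (n + 1) <;> by_cases h : Even i
  · have : Even (n + 1 - i) := (Nat.even_sub hi).2 (by tauto)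
    simp [hn, h, this, Nat.even_iff.1 this]
  · have : ¬ Even (n + 1 - i) := fun h' => h ((((Nat.even_sub hi).1 h')).1 hn)
    simp [hn, h, this, Nat.not_even_iff.1 this]
  · have : ¬ Even (n + 1 - i) := fun h' => hn ((((Nat.even_sub hi).1 h')).2 h)
    simp [hn, h, this, Nat.not_even_iff.1 this]
  · have : Even (n + 1 - i) := (Nat.even_sub hi).2 (by tauto)
    simp [hn, h, this, Nat.even_iff.1 this]

theorem gen_apply (n : ℕ) (m : ℤ) (i : Fin (n + 1)) :
    gen k a q n m i = if m = (i : ℕ) then 1 else 0 := by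
  have := i.2
  rw [gen]
  split_ifs with h1 h2 h2
  · rw [Finsupp.single_apply, if_pos]
    ext
    simp [h2]
  · rw [Finsupp.single_apply, if_neg]
    intro h
    apply h2
    rw [← h]
    simp [h1.1]
  · omega
  · rfl

theorem gen_natCast (n : ℕ) (i : Fin (n + 1)) : gen k a q n (i : ℕ) = Finsupp.single i 1 := by
  ext j
  rw [gen_apply, Finsupp.single_apply]
  simp [Fin.ext_iff]

theorem d_apply (n : ℕ) (z : P k a q (n + 1)) (i : Fin (n + 1)) : d k a q n z i =
    z i.castSucc * coefY k a q i (n + 1 - i) + z i.succ * coefX k a q (i + 1) (n - i) := by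
  induction z using Finsupp.induction_linear with
  | zero => simp
  | add z w hz hw =>
    rw [map_add, Finsupp.add_apply, hz, hw, Finsupp.add_apply, Finsupp.add_apply]
    noncomm_ring
  | single j e =>
    have hj := j.2
    have h1 : d k a q n (Finsupp.single j e) = e • dgen k a q n (j : ℕ) := by
      rw [← d_single, ← map_smul, Finsupp.smul_single, smul_eq_mul, mul_one]
    rw [h1, dgen_eq n j (by omega), Finsupp.smul_apply, Finsupp.add_apply, Finsupp.smul_apply,
      Finsupp.smul_apply, gen_apply, gen_apply, Finsupp.single_apply, Finsupp.single_apply]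
    simp only [smul_eq_mul, mul_add]
    by_cases h2 : (j : ℕ) = i
    · have h3 : j = i.castSucc := Fin.ext h2
      rw [if_pos (by omega), if_neg (by omega), if_pos h3,
        if_neg (fun h => by have := congrArg Fin.val h; simp at this; omega), h2]
      simp
    · by_cases h4 : (j : ℕ) = i + 1
      · have h5 : j = i.succ := Fin.ext (by simpa using h4)
        rw [if_neg (by omega), if_pos (by omega),
          if_neg (fun h => by have := congrArg Fin.val h; simp at this; omega), if_pos h5, h4,
          show n + 1 - (i + 1 : ℕ) = n - i by omega]
        simp
      · rw [if_neg (by omega), if_neg (by omega),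
          if_neg (fun h => by have := congrArg Fin.val h; simp at this; omega),
          if_neg (fun h => by have := congrArg Fin.val h; simp at this; omega)]
        simp

theorem x_pow_mem_filA (i : ℕ) : x k a q ^ i ∈ filA k a q i := by
  have : x k a q ^ i = mon k a q 0 i := by simp [mon]
  rw [this]
  exact mon_mem_filA (by simp)

theorem y_pow_mem_filA (i : ℕ) : y k a q ^ i ∈ filA k a q i := by
  have : y k a q ^ i = mon k a q i 0 := by simp [mon]
  rw [this]
  exact mon_mem_filA (by simp)

theorem xx_mem_filE (hq0 : q ≠ 0) (i j : ℕ) : xx k a q i j ∈ filE k a q (i + j) := by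
  rw [xx]
  exact tens_mem_filE hq0 (x_pow_mem_filA i) (x_pow_mem_filA j)

theorem yy_mem_filE (hq0 : q ≠ 0) (i j : ℕ) : yy k a q i j ∈ filE k a q (i + j) := by
  rw [yy]
  exact tens_mem_filE hq0 (y_pow_mem_filA i) (y_pow_mem_filA j)

theorem tauX_mem_filE (hq0 : q ≠ 0) (s : ℕ) : tauX k a q s ∈ filE k a q 1 := by
  rw [tauX]
  exact sub_mem (Submodule.smul_mem _ _ (by simpa using xx_mem_filE hq0 0 1))
    (by simpa using xx_mem_filE hq0 1 0)

theorem tauY_mem_filE (hq0 : q ≠ 0) (s : ℕ) : tauY k a q s ∈ filE k a q 1 := by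
  rw [tauY]
  exact sub_mem (by simpa using yy_mem_filE hq0 0 1)
    (Submodule.smul_mem _ _ (by simpa using yy_mem_filE hq0 1 0))

theorem gammaX_mem_filE (hq0 : q ≠ 0) (s : ℕ) : gammaX k a q s ∈ filE k a q (a - 1) := by
  rw [gammaX]
  refine sum_mem fun j hj => Submodule.smul_mem _ _ ?_
  have := Finset.mem_range.1 hj
  exact filE_mono (by omega) (xx_mem_filE hq0 _ _)

theorem gammaY_mem_filE (hq0 : q ≠ 0) (s : ℕ) : gammaY k a q s ∈ filE k a q (a - 1) := by
  rw [gammaY]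
  refine sum_mem fun j hj => Submodule.smul_mem _ _ ?_
  have := Finset.mem_range.1 hj
  exact filE_mono (by omega) (yy_mem_filE hq0 _ _)

theorem coefX_mem_filE (hq0 : q ≠ 0) (i j : ℕ) :
    coefX k a q (i + 1) j ∈ filE k a q (wt a (i + 1) - wt a i) := by
  simp only [coefX, Nat.even_add_one]
  split_ifs with h
  · rw [wt_succ_of_even h, add_sub_cancel_left]
    exact tauX_mem_filE hq0 _
  · rw [wt_succ_of_odd h, add_sub_cancel_left]
    exact gammaX_mem_filE hq0 _

theorem coefY_mem_filE (hq0 : q ≠ 0) (i j : ℕ) :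
    coefY k a q i (j + 1) ∈ filE k a q (wt a (j + 1) - wt a j) := by
  simp only [coefY, Nat.even_add_one]
  split_ifs with h h' h'
  · rw [wt_succ_of_even h, add_sub_cancel_left]
    exact tauY_mem_filE hq0 _
  · rw [wt_succ_of_even h, add_sub_cancel_left]
    exact neg_mem (tauY_mem_filE hq0 _)
  · rw [wt_succ_of_odd h, add_sub_cancel_left]
    exact gammaY_mem_filE hq0 _
  · rw [wt_succ_of_odd h, add_sub_cancel_left]
    exact neg_mem (gammaY_mem_filE hq0 _)

/-! ### Strict exactness -/

variable (k a q) in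
/-- The elements of `P_n` of degree at least `v`. -/
def filP (n : ℕ) (v : ℤ) : Submodule k (P k a q n) where
  -- The generator `f^n_i` itself counts with degree `wt i + wt (n - i)`.
  carrier := {z | ∀ i : Fin (n + 1), z i ∈ filE k a q (v - wt a i - wt a (n - i))}
  add_mem' hz hw i := add_mem (hz i) (hw i)
  zero_mem' _ := zero_mem _
  smul_mem' r _ hz i := Submodule.smul_mem _ r (hz i)

theorem single_mem_filP {n : ℕ} {v : ℤ} {i : Fin (n + 1)} {e : E k a q}
    (he : e ∈ filE k a q (v - wt a i - wt a (n - i))) : Finsupp.single i e ∈ filP k a q n v := by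
  intro j
  rw [Finsupp.single_apply]
  split_ifs with h
  · exact h ▸ he
  · exact zero_mem _

theorem filP_eq_top (hq0 : q ≠ 0) (n : ℕ) : filP k a q n 0 = ⊤ := by
  refine eq_top_iff.2 fun z _ i => ?_
  have h1 := wt_nonneg (a := a) i
  have h2 := wt_nonneg (a := a) (n - i)
  rw [filE_eq_top hq0 (by linarith)]
  trivial

theorem smul_mem_filP (hq0 : q ≠ 0) {n : ℕ} {v w : ℤ} {e : E k a q} {z : P k a q n}
    (he : e ∈ filE k a q v) (hz : z ∈ filP k a q n w) : e • z ∈ filP k a q n (v + w) := by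
  intro i
  have := filE_mul hq0 he (hz i)
  rwa [← add_sub_assoc, ← add_sub_assoc] at this

theorem d_mem_filP (hq0 : q ≠ 0) {n : ℕ} {v : ℤ} {z : P k a q (n + 1)}
    (hz : z ∈ filP k a q (n + 1) v) : d k a q n z ∈ filP k a q n v := by
  intro i
  have hi : (i : ℕ) ≤ n := Nat.lt_succ_iff.1 i.2
  rw [d_apply]
  have h1 := filE_mul hq0 (hz i.castSucc) (coefY_mem_filE hq0 i (n - i))
  have h2 := filE_mul hq0 (hz i.succ) (coefX_mem_filE hq0 i (n - i))
  rw [show n - (i : ℕ) + 1 = n + 1 - i by omega] at h1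
  simp only [Fin.val_castSucc, Fin.val_succ, show n + 1 - (i + 1 : ℕ) = n - i by omega] at h1 h2
  exact add_mem (filE_mono (by linarith) h1) (filE_mono (by linarith) h2)

theorem exists_coefX (ha : 3 ≤ a) (hq : IsPrimitiveRoot q a) {i j : ℕ} {v : ℤ} {e : E k a q}
    (he : e ∈ filE k a q v) (h0 : e * coefX k a q (i + 1) j = 0) :
    ∃ w ∈ filE k a q (v - (wt a (i + 2) - wt a (i + 1))), w * coefX k a q (i + 2) j = e := by
  simp only [coefX, Nat.even_add_one] at h0
  simp only [coefX, Nat.even_add_one]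
  split_ifs at h0 with h
  · rw [if_pos (not_not.2 h), wt_succ_of_odd (i := i + 1) (by rwa [Nat.even_add_one, not_not]),
      add_sub_cancel_left]
    exact mem_filMul_gammaX ha hq he h0
  · rw [if_neg (not_not.not.2 h), wt_succ_of_even (i := i + 1) (by rwa [Nat.even_add_one]),
      add_sub_cancel_left]
    exact mem_filMul_tauX ha hq he h0

theorem exists_coefY_add_coefX (ha : 3 ≤ a) (hq : IsPrimitiveRoot q a) {j : ℕ} {v : ℤ}
    {e w : E k a q} (he : e ∈ filE k a q v)
    (h0 : e * coefY k a q 0 (j + 1) + w * coefX k a q 1 j = 0) :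
    ∃ w₀ ∈ filE k a q (v - (wt a (j + 2) - wt a (j + 1))), ∃ w₁ ∈ filE k a q (v - 1),
      w₀ * coefY k a q 0 (j + 2) + w₁ * coefX k a q 1 (j + 1) = e := by
  have h0' := eq_neg_of_add_eq_zero_left h0
  rw [← neg_mul] at h0'
  have h1 : ¬ Even 1 := by decide
  by_cases h : Even j
  · have h2 : Even (j + 2) := by rwa [Nat.even_add_one, Nat.even_add_one, not_not]
    have h3 : ¬ Even (j + 1) := by rwa [Nat.even_add_one, not_not]
    rw [coefY, coefX, if_neg h3, if_neg h1, if_pos Even.zero, Nat.even_iff.1 h] at h0'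
    obtain ⟨w₀, hw₀, w₁, hw₁, h4⟩ := exists_gammaY_add_tauX ha hq he h0'
    refine ⟨w₀, ?_, w₁, hw₁, ?_⟩
    · rwa [wt_succ_of_odd h3, add_sub_cancel_left]
    · rwa [coefY, coefX, if_pos h2, if_neg h1, if_pos Even.zero, Nat.not_even_iff.1 h3]
  · have h2 : ¬ Even (j + 2) := by rwa [Nat.even_add_one, Nat.even_add_one, not_not]
    have h3 : Even (j + 1) := by rwa [Nat.even_add_one]
    rw [coefY, coefX, if_pos h3, if_neg h1, if_pos Even.zero, Nat.not_even_iff.1 h] at h0'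
    obtain ⟨w₀, hw₀, w₁, hw₁, h4⟩ := exists_tauY_add_tauX ha hq he h0'
    refine ⟨w₀, ?_, w₁, hw₁, ?_⟩
    · rwa [wt_succ_of_even h3, add_sub_cancel_left]
    · rwa [coefY, coefX, if_neg h2, if_neg h1, if_pos Even.zero, Nat.even_iff.1 h3]

/-- A cycle is reduced to zero one coordinate at a time. Coordinate zero needs exactness of the
first column modulo `τ_x`. Once the coordinates up to `s` vanish, coordinate `s` of the cycle
condition puts coordinate `s + 1` in the kernel of a row map, and rows are exact. Each correction
respects the degree. -/
theorem exists_d_eq_of_lt (ha : 3 ≤ a) (hq : IsPrimitiveRoot q a) {n : ℕ} {v : ℤ}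
    {z : P k a q (n + 1)} (hz : z ∈ filP k a q (n + 1) v) (hd : d k a q n z = 0) (r : ℕ)
    (hr : r ≤ n + 2) : ∃ w ∈ filP k a q (n + 2) v,
      ∀ i : Fin (n + 2), (i : ℕ) < r → (z - d k a q (n + 1) w) i = 0 := by
  have hq0 : q ≠ 0 := hq.ne_zero (by omega)
  induction r with
  | zero => exact ⟨0, zero_mem _, fun i hi => absurd hi (Nat.not_lt_zero _)⟩
  | succ r ih =>
    obtain ⟨w, hw, h⟩ := ih (by omega)
    have hz' : z - d k a q (n + 1) w ∈ filP k a q (n + 1) v := sub_mem hz (d_mem_filP hq0 hw)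
    have hd' : d k a q n (z - d k a q (n + 1) w) = 0 := by
      rw [map_sub, hd, zero_sub, neg_eq_zero]
      exact LinearMap.congr_fun (d_comp_d hq n) w
    suffices ∃ w' ∈ filP k a q (n + 2) v, ∀ i : Fin (n + 2), (i : ℕ) < r + 1 →
        d k a q (n + 1) w' i = (z - d k a q (n + 1) w) i by
      obtain ⟨w', hw', h'⟩ := this
      refine ⟨w + w', add_mem hw hw', fun i hi => ?_⟩
      rw [map_add, ← sub_sub, Finsupp.sub_apply, h' i hi, sub_self]
    generalize z - d k a q (n + 1) w = z' at *
    cases r with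
    | zero =>
      have h0 := DFunLike.congr_fun hd' (0 : Fin (n + 1))
      rw [d_apply] at h0
      obtain ⟨w₀, hw₀, w₁, hw₁, h1⟩ := exists_coefY_add_coefX ha hq (hz' _) h0
      refine ⟨Finsupp.single 0 w₀ + Finsupp.single 1 w₁, add_mem (single_mem_filP ?_)
        (single_mem_filP ?_), fun i hi => ?_⟩
      · refine filE_mono (le_of_eq ?_) hw₀
        simp
      · refine filE_mono (le_of_eq ?_) hw₁
        simp [wt]
        ring
      · obtain rfl : i = 0 := Fin.ext (by simpa using hi)
        have e1 : (Finsupp.single 0 w₀ + Finsupp.single 1 w₁ : P k a q (n + 2))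
            (Fin.castSucc 0) = w₀ := by simp
        have e2 : (Finsupp.single 0 w₀ + Finsupp.single 1 w₁ : P k a q (n + 2))
            (Fin.succ 0) = w₁ := by simp
        rw [d_apply, e1, e2]
        exact h1
    | succ s =>
      have hs : s < n + 1 := by omega
      have h0 := DFunLike.congr_fun hd' (⟨s, hs⟩ : Fin (n + 1))
      rw [d_apply, h _ (by simp), zero_mul, zero_add] at h0
      obtain ⟨w', hw', h1⟩ := exists_coefX ha hq (hz' _) h0
      -- The boundary of an element at place `s + 2` touches only the places `s + 1` and `s + 2`, so
      -- earlier coordinates stay zero.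
      refine ⟨Finsupp.single ⟨s + 2, by omega⟩ w', single_mem_filP ?_, fun i hi => ?_⟩
      · refine filE_mono (le_of_eq ?_) hw'
        simp only [Fin.val_succ, show n + 2 - (s + 2) = n - s by omega,
          show n + 1 - (s + 1) = n - s by omega]
        ring
      · rw [d_apply, Finsupp.single_apply, Finsupp.single_apply,
          if_neg (fun h => by have := congrArg Fin.val h; simp at this; omega), zero_mul, zero_add]
        by_cases his : (i : ℕ) = s + 1
        · obtain rfl : i = Fin.succ ⟨s, hs⟩ := Fin.ext his
          rw [if_pos (Fin.ext (by simp))]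
          simpa using h1
        · rw [if_neg (fun h => by have := congrArg Fin.val h; simp at this; omega), zero_mul,
            h i (by omega)]

variable (k a q) in
/-- The cycles of the augmented complex. -/
def cycles : ∀ n : ℕ, Submodule (E k a q) (P k a q n)
  | 0 => LinearMap.ker (cochain k a q 0 fun _ => 1)
  | n + 1 => LinearMap.ker (d k a q n)

theorem exists_d_eq (ha : 3 ≤ a) (hq : IsPrimitiveRoot q a) {n : ℕ} {v : ℤ}
    {z : P k a q n} (hz : z ∈ filP k a q n v) (hd : z ∈ cycles k a q n) :
    ∃ w ∈ filP k a q (n + 1) v, d k a q n w = z := by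
  cases n with
  | zero =>
    have hq0 : q ≠ 0 := hq.ne_zero (by omega)
    have h0 : z 0 • (1 : QCI k a q) = 0 := by
      have : cochain k a q 0 (fun _ => 1) z = 0 := hd
      rw [cochain, Finsupp.linearCombination_apply, Finsupp.sum_fintype _ _ (by simp)] at this
      simpa using this
    obtain ⟨w₀, hw₀, w₁, hw₁, h1⟩ := exists_tauY_add_tauX_of_smul_one hq0 (hz 0) h0
    refine ⟨Finsupp.single 0 w₀ + Finsupp.single 1 w₁, add_mem (single_mem_filP ?_)
        (single_mem_filP ?_), ?_⟩
    · refine filE_mono (le_of_eq ?_) hw₀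
      simp [wt]
    · refine filE_mono (le_of_eq ?_) hw₁
      simp [wt]
    · ext i
      obtain rfl : i = 0 := Fin.ext (by omega)
      rw [d_apply]
      have e1 : (Finsupp.single 0 w₀ + Finsupp.single 1 w₁ : P k a q 1)
          (Fin.castSucc 0) = w₀ := by simp
      have e2 : (Finsupp.single 0 w₀ + Finsupp.single 1 w₁ : P k a q 1)
          (Fin.succ 0) = w₁ := by simp
      rw [e1, e2, ← h1]
      simp [coefY, coefX]
  | succ n =>
    obtain ⟨w, hw, h⟩ := exists_d_eq_of_lt ha hq hz hd (n + 2) le_rfl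
    refine ⟨w, hw, (sub_eq_zero.1 ?_).symm⟩
    ext i
    exact h i i.2

theorem cochain_one_single_tens (m : QCI k a q) :
    cochain k a q 0 (fun _ => 1) (Finsupp.single 0 (tens k m 1)) = m := by
  rw [cochain, Finsupp.linearCombination_single, tens_smul, mul_one, mul_one]

/-- The augmented complex is exact. -/
theorem quasiIso_augmentation (ha : 3 ≤ a) (hq : IsPrimitiveRoot q a) :
    QuasiIso (augmentation hq) := by
  have hq0 : q ≠ 0 := hq.ne_zero (by omega)
  refine ⟨fun n => ?_⟩
  cases n with
  | zero =>
    rw [ChainComplex.quasiIsoAt₀_iff, ShortComplex.quasiIso_iff_of_zeros']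
    · rw [ShortComplex.moduleCat_exact_iff, ModuleCat.epi_iff_surjective]
      refine ⟨fun z hz => ?_, fun m => ?_⟩
      · have hz' : z ∈ cycles k a q 0 := by
          have h := ChainComplex.toSingle₀Equiv_symm_apply_f_zero
            (cochainHom hq 0 fun _ => 1) (d_comp_mu hq)
          exact (congrArg (fun f => f.hom z) h).symm.trans hz
        obtain ⟨w, -, hw⟩ := exists_d_eq ha hq (v := 0) (by rw [filP_eq_top hq0]; trivial) hz'
        refine ⟨w, ?_⟩
        have h := (resolutionComplex_d (k := k) hq 0)
        exact (congrArg (fun f => f.hom w) h).trans hw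
      · have h := ChainComplex.toSingle₀Equiv_symm_apply_f_zero
          (cochainHom hq 0 fun _ => 1) (d_comp_mu hq)
        refine ⟨(Finsupp.single 0 (tens k m 1) : P k a q 0), ?_⟩
        refine (congrArg (fun f => f.hom (Finsupp.single 0 (tens k m 1) : P k a q 0)) h).trans ?_
        exact cochain_one_single_tens m
    all_goals rfl
  | succ n =>
    rw [quasiIsoAt_iff_exactAt']
    · rw [HomologicalComplex.exactAt_iff' _ (n + 1 + 1) (n + 1) n (by simp) (by simp),
        ShortComplex.moduleCat_exact_iff]
      intro z hz
      have hz' : z ∈ cycles k a q (n + 1) := by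
        have h := (resolutionComplex_d (k := k) hq n)
        exact (congrArg (fun f => f.hom z) h).symm.trans hz
      obtain ⟨w, -, hw⟩ := exists_d_eq ha hq (v := 0)
        (by rw [filP_eq_top hq0]; trivial) hz'
      refine ⟨w, ?_⟩
      have h := (resolutionComplex_d (k := k) hq (n + 1))
      exact (congrArg (fun f => f.hom w) h).trans hw
    · apply ChainComplex.exactAt_succ_single_obj

end Exactness
end HH
end

/-! ### Chain maps lifting a cocycle: lifts compatible with degrees, and index shifts. -/

noncomputable section

namespace HH

section Lift

variable {k : Type u} [Field k] {a : ℕ} {q : k}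

/-- A map of free modules that raises degrees by at least `u`. -/
def RaisesDegree {m n : ℕ} (u : ℤ) (φ : P k a q m →ₗ[E k a q] P k a q n) : Prop :=
  ∀ (v : ℤ) (z : P k a q m), z ∈ filP k a q m v → φ z ∈ filP k a q n (v + u)

theorem single_one_mem_filP (hq0 : q ≠ 0) {n : ℕ} (i : Fin (n + 1)) :
    (Finsupp.single i 1 : P k a q n) ∈ filP k a q n (wt a i + wt a (n - i)) := by
  refine single_mem_filP ?_
  rw [filE_eq_top hq0 (by linarith)]
  trivial

theorem exists_raisesDegree (hq0 : q ≠ 0) {m n : ℕ} {u : ℤ}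
    (Q : Fin (m + 1) → P k a q n → Prop)
    (h : ∀ i : Fin (m + 1), ∃ z ∈ filP k a q n (wt a i + wt a (m - i) + u), Q i z) :
    ∃ φ : P k a q m →ₗ[E k a q] P k a q n, RaisesDegree u φ ∧
      ∀ i, Q i (φ (Finsupp.single i 1)) := by
  choose z hz hQ using h
  refine ⟨Finsupp.linearCombination (E k a q) z, fun v w hw => ?_, fun i => ?_⟩
  · rw [Finsupp.linearCombination_apply, Finsupp.sum_fintype _ _ (by simp)]
    refine sum_mem fun i _ => ?_
    have := smul_mem_filP hq0 (hw i) (hz i)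
    rwa [show v - wt a i - wt a (m - i) + (wt a i + wt a (m - i) + u) = v + u by ring] at this
  · rw [Finsupp.linearCombination_single, one_smul]
    exact hQ i

/-- A cocycle that raises degrees by at least `u` lifts to a chain map that raises degrees by at
least `u`. -/
theorem exists_lift (ha : 3 ≤ a) (hq : IsPrimitiveRoot q a) {n : ℕ} {u : ℤ}
    (f : P k a q n →ₗ[E k a q] QCI k a q) (hf : f ∘ₗ d k a q n = 0)
    (hu : ∀ i : Fin (n + 1),
      f (Finsupp.single i 1) ∈ filA k a q (wt a i + wt a (n - i) + u)) :
    ∃ φ : ∀ m : ℕ, P k a q (n + m) →ₗ[E k a q] P k a q m,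
      cochain k a q 0 (fun _ => 1) ∘ₗ φ 0 = f ∧
      (∀ m, d k a q m ∘ₗ φ (m + 1) = φ m ∘ₗ d k a q (n + m)) ∧ ∀ m, RaisesDegree u (φ m) := by
  have hq0 : q ≠ 0 := hq.ne_zero (by omega)
  -- Carrying along that `φ ∘ d` takes cycles as values lets each lift be chosen from the preceding
  -- one alone.
  let S : ℕ → Type u := fun m => {φ : P k a q (n + m) →ₗ[E k a q] P k a q m //
    RaisesDegree u φ ∧ ∀ z, φ (d k a q (n + m) z) ∈ cycles k a q m}
  have step : ∀ m (φ : S m), ∃ ψ : S (m + 1), d k a q m ∘ₗ ψ.1 = φ.1 ∘ₗ d k a q (n + m) := by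
    rintro m ⟨φ, hφ, hc⟩
    -- Strict exactness supplies, for each generator, a preimage of the right degree.
    obtain ⟨ψ, hψ, he⟩ := exists_raisesDegree (k := k) (a := a) hq0 (m := n + (m + 1))
      (n := m + 1) (u := u) (fun i z => d k a q m z = φ (d k a q (n + m) (Finsupp.single i 1)))
      fun i => exists_d_eq ha hq
        (hφ _ _ (d_mem_filP hq0 (single_one_mem_filP hq0 (n := n + m + 1) i))) (hc _)
    have he' : d k a q m ∘ₗ ψ = φ ∘ₗ d k a q (n + m) :=
      Finsupp.lhom_ext' fun i => LinearMap.ext_ring (he i)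
    refine ⟨⟨ψ, hψ, fun z => ?_⟩, he'⟩
    change d k a q m (ψ (d k a q (n + (m + 1)) z)) = 0
    have h1 := LinearMap.congr_fun he' (d k a q (n + (m + 1)) z)
    have h2 : d k a q (n + m) (d k a q (n + (m + 1)) z) = 0 :=
      LinearMap.congr_fun (d_comp_d hq (n + m)) z
    refine h1.trans ?_
    change φ (d k a q (n + m) (d k a q (n + (m + 1)) z)) = 0
    rw [h2, map_zero]
  obtain ⟨φ₀, hφ₀, he₀⟩ := exists_raisesDegree (k := k) (a := a) hq0 (m := n) (n := 0) (u := u)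
    (fun i z => cochain k a q 0 (fun _ => 1) z = f (Finsupp.single i 1))
    fun i => by
      refine ⟨Finsupp.single 0 (tens k (f (Finsupp.single i 1)) 1), single_mem_filP ?_,
        cochain_one_single_tens _⟩
      have := tens_mem_filE hq0 (hu i) (x_pow_mem_filA (k := k) (a := a) (q := q) 0)
      rw [pow_zero] at this
      refine filE_mono (le_of_eq ?_) this
      simp [wt]
  have he₀' : cochain k a q 0 (fun _ => 1) ∘ₗ φ₀ = f :=
    Finsupp.lhom_ext' fun i => LinearMap.ext_ring (he₀ i)
  have hc₀ : ∀ z, φ₀ (d k a q n z) ∈ cycles k a q 0 := fun z =>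
    (LinearMap.congr_fun he₀' (d k a q n z)).trans (LinearMap.congr_fun hf z)
  choose next hnext using step
  let φ : ∀ m, S m := fun m => Nat.rec ⟨φ₀, hφ₀, hc₀⟩ next m
  exact ⟨fun m => (φ m).1, he₀', fun m => hnext m (φ m), fun m => (φ m).2.1⟩

theorem cochain_apply_mem_filA {n : ℕ} {v u : ℤ} (g : P k a q n →ₗ[E k a q] QCI k a q)
    (hu : ∀ i : Fin (n + 1),
      g (Finsupp.single i 1) ∈ filA k a q (wt a i + wt a (n - i) + u))
    {z : P k a q n} (hz : z ∈ filP k a q n v) : g z ∈ filA k a q (v + u) := by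
  have : z = ∑ i, z i • Finsupp.single i 1 := by
    conv_lhs => rw [← Finsupp.sum_single z, Finsupp.sum_fintype _ _ (by simp)]
    simp
  rw [this, map_sum]
  refine sum_mem fun i _ => ?_
  rw [map_smul]
  have := smul_mem_filA (hz i) (hu i)
  rwa [show v - wt a i - wt a (n - i) + (wt a i + wt a (n - i) + u) = v + u by ring] at this

end Lift

section Shift

variable (k : Type u) [Field k] (a : ℕ) (q : k)

/-- The map `f_i ↦ f_{i - j}`. -/
def shift (j n m : ℕ) : P k a q n →ₗ[E k a q] P k a q m :=
  Finsupp.linearCombination (E k a q) fun i : Fin (n + 1) => gen k a q m ((i : ℕ) - (j : ℤ))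

variable {k a q}

theorem shift_gen {j n m : ℕ} (hj : m + j ≤ n) (i : ℤ) :
    shift k a q j n m (gen k a q n i) = gen k a q m (i - j) := by
  by_cases h : 0 ≤ i ∧ i < n + 1
  · have := h.1
    rw [gen, dif_pos h, shift, Finsupp.linearCombination_single, one_smul,
      Int.toNat_of_nonneg h.1]
  · have h' : ¬ (0 ≤ i - j ∧ i - j < m + 1) := by omega
    rw [gen, dif_neg h, map_zero, gen, dif_neg h']

/-- The differential depends only on the parities of the two indices, which an even shift preserves.
-/
theorem d_comp_shift {j n m : ℕ} (hj : m + j ≤ n) (hj' : Even j) (hn : Even n ↔ Even m) :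
    d k a q m ∘ₗ shift k a q j (n + 1) (m + 1) = shift k a q j n m ∘ₗ d k a q n := by
  refine Finsupp.lhom_ext' fun i => LinearMap.ext_ring ?_
  change d k a q m (shift k a q j (n + 1) (m + 1) (Finsupp.single i 1)) =
    shift k a q j n m (d k a q n (Finsupp.single i 1))
  have h1 : Even (n + 1) ↔ Even (m + 1) := by rw [Nat.even_add_one, Nat.even_add_one, hn]
  have h2 : Even (((i : ℕ) : ℤ) - j) ↔ Even ((i : ℕ) : ℤ) := by
    rw [Int.even_sub]
    simp [hj']
  have h3 : ((i : ℕ) : ℤ) - j - 1 = (i : ℕ) - 1 - j := by ring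
  rw [← gen_natCast, shift_gen (by omega), d_gen, d_gen, dgen, dgen]
  simp only [h1, h2, h3]
  split_ifs <;> simp only [map_add, map_smul, shift_gen hj]

theorem cochain_comp_shift {j n m : ℕ} (hj : m + j ≤ n) (p : ℕ → QCI k a q) :
    cochain k a q m p ∘ₗ shift k a q j n m =
      cochain k a q n fun i => if j ≤ i ∧ i ≤ m + j then p (i - j) else 0 := by
  refine Finsupp.lhom_ext' fun i => LinearMap.ext_ring ?_
  change cochain k a q m p (shift k a q j n m (Finsupp.single i 1)) =
    cochain k a q n (fun i => if j ≤ i ∧ i ≤ m + j then p (i - j) else 0) (Finsupp.single i 1)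
  have h : (0 ≤ ((i : ℕ) : ℤ) - j ∧ ((i : ℕ) : ℤ) - j < m + 1) ↔
      (j ≤ (i : ℕ) ∧ (i : ℕ) ≤ m + j) := by
    omega
  have hi : 0 ≤ ((i : ℕ) : ℤ) ∧ ((i : ℕ) : ℤ) < n + 1 := by omega
  rw [← gen_natCast, shift_gen hj, cochain_gen, cochain_gen, if_congr h rfl rfl, if_pos hi,
    Int.toNat_natCast]
  split_ifs
  · congr 1
    omega
  · rfl

end Shift
end HH
end

/-! ### Cocycles representing classes, coboundaries, and the degree of a class. -/

noncomputable section

namespace CategoryTheory.ProjectiveResolution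

open CochainComplex HomComplex Abelian

universe w v u'

variable {C : Type u'} [Category.{v} C] [Abelian C] [HasExt.{w} C] {X Y : C}
  (R : ProjectiveResolution X)

/-- There are no coboundaries in degree zero, as the extended complex vanishes in degree `1`. -/
theorem extMk_zero_eq_zero_iff (f : R.complex.X 0 ⟶ Y) (hf : R.complex.d 1 0 ≫ f = 0) :
    R.extMk f 1 rfl hf = 0 ↔ f = 0 := by
  refine ⟨fun h => ?_, fun h => ?_⟩
  · rw [← R.extEquivCohomologyClass.apply_eq_iff_eq, extEquivCohomologyClass_extMk,
      extEquivCohomologyClass_zero, CohomologyClass.mk_eq_zero_iff,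
      Cocycle.toSingleMk_mem_coboundaries_iff _ _ _ _ _ 1 (by simp)] at h
    obtain ⟨g, hg⟩ := h
    rw [(R.isZero_cochainComplex_X 1 one_pos).eq_of_src g 0, Limits.comp_zero] at hg
    rw [← cancel_epi (R.cochainComplexXIso (-(0 : ℕ)) 0 rfl).hom, ← hg, Limits.comp_zero]
  · subst h
    exact R.extMk_zero 1 rfl

end CategoryTheory.ProjectiveResolution

namespace HH

section Represents

variable {k : Type u} [Field k] {a : ℕ} {q : k} {hq : IsPrimitiveRoot q a}
  (hP : QuasiIso (augmentation hq))

theorem resolutionComplex_d_comp_ofHom {n : ℕ} {f : P k a q n →ₗ[E k a q] QCI k a q}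
    (hf : f ∘ₗ d k a q n = 0) :
    (resolution hq hP).complex.d (n + 1) n ≫
      (ModuleCat.ofHom f : ModuleCat.of (E k a q) (P k a q n) ⟶ bimod k (QCI k a q)) = 0 := by
  change (resolutionComplex hq).d (n + 1) n ≫ _ = 0
  rw [resolutionComplex_d]
  exact (ModuleCat.ofHom_comp _ _).symm.trans (congrArg ModuleCat.ofHom hf)

/-- The cocycle `f` represents the class `z`. -/
def Represents {n : ℕ} (f : P k a q n →ₗ[E k a q] QCI k a q) (z : Coh k (QCI k a q) n) : Prop :=
  ∃ hf : f ∘ₗ d k a q n = 0, (resolution hq hP).extMk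
    (ModuleCat.ofHom f : ModuleCat.of (E k a q) (P k a q n) ⟶ bimod k (QCI k a q)) (n + 1) rfl
      (resolutionComplex_d_comp_ofHom hP hf) = z

variable {hP}

theorem exists_represents {n : ℕ} (z : Coh k (QCI k a q) n) :
    ∃ f : P k a q n →ₗ[E k a q] QCI k a q, Represents hP f z := by
  obtain ⟨f, hf, rfl⟩ := (resolution hq hP).extMk_surjective z (n + 1) rfl
  have hf' : (resolutionComplex hq).d (n + 1) n ≫ f = 0 := hf
  rw [resolutionComplex_d] at hf'
  exact ⟨f.hom, congrArg ModuleCat.Hom.hom hf', rfl⟩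

namespace Represents

variable {n : ℕ} {f g : P k a q n →ₗ[E k a q] QCI k a q} {z w : Coh k (QCI k a q) n}

theorem add (h : Represents hP f z) (h' : Represents hP g w) : Represents hP (f + g) (z + w) := by
  obtain ⟨hf, rfl⟩ := h
  obtain ⟨hg, rfl⟩ := h'
  refine ⟨by rw [LinearMap.add_comp, hf, hg, add_zero], ?_⟩
  exact ((resolution hq hP).add_extMk _ _ _ _ _ _).symm

theorem sub (h : Represents hP f z) (h' : Represents hP g w) : Represents hP (f - g) (z - w) := by
  obtain ⟨hf, rfl⟩ := h
  obtain ⟨hg, rfl⟩ := h'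
  refine ⟨by rw [LinearMap.sub_comp, hf, hg, sub_zero], ?_⟩
  exact ((resolution hq hP).sub_extMk _ _ _ _ _ _).symm

theorem zero : Represents hP (0 : P k a q n →ₗ[E k a q] QCI k a q) 0 :=
  ⟨LinearMap.zero_comp _, (resolution hq hP).extMk_zero _ _⟩

theorem smul (r : k) (h : Represents hP f z) : Represents hP (r • f) (r • z) := by
  obtain ⟨hf, rfl⟩ := h
  refine ⟨by rw [LinearMap.smul_comp, hf, smul_zero], ?_⟩
  -- The scalar action on `Ext` is postcomposition with a multiple of the identity.
  refine Eq.trans ?_ (((resolution hq hP).extMk_comp_mk₀ _ _ rfl _ _).symm.trans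
    (Abelian.Ext.smul_eq_comp_mk₀ _ _).symm)
  congr 1
  refine ModuleCat.hom_ext (LinearMap.ext fun m => ?_)
  change r • f m = (algebraMap k (E k a q) r) • f m
  rw [algebraMap_smul]

theorem congr_left (h : Represents hP f z) (hfg : f = g) : Represents hP g z := hfg ▸ h

theorem eq_zero (h : Represents hP (0 : P k a q n →ₗ[E k a q] QCI k a q) z) : z = 0 := by
  obtain ⟨_, rfl⟩ := h
  exact (resolution hq hP).extMk_zero _ _

theorem unique (h : Represents hP f z) (h' : Represents hP f w) : z = w := by
  obtain ⟨_, rfl⟩ := h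
  obtain ⟨_, rfl⟩ := h'
  rfl

/-- The Yoneda product of classes is represented by the composite with a lift. -/
theorem comp {m : ℕ} {g : P k a q m →ₗ[E k a q] QCI k a q} {w : Coh k (QCI k a q) m}
    (h : Represents hP f z) (h' : Represents hP g w) (hn : Even n)
    (φ : ∀ i : ℕ, P k a q (n + i) →ₗ[E k a q] P k a q i)
    (hφ0 : cochain k a q 0 (fun _ => 1) ∘ₗ φ 0 = f)
    (hφ : ∀ i, d k a q i ∘ₗ φ (i + 1) = φ i ∘ₗ d k a q (n + i)) :
    Represents hP (g ∘ₗ φ m) (z.comp w rfl) := by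
  obtain ⟨hf, rfl⟩ := h
  obtain ⟨hg, rfl⟩ := h'
  have hfg : (g ∘ₗ φ m) ∘ₗ d k a q (n + m) = 0 := by
    rw [LinearMap.comp_assoc, ← hφ, ← LinearMap.comp_assoc, hg, LinearMap.zero_comp]
  refine ⟨hfg, Eq.symm ?_⟩
  refine (resolution hq hP).extMk_comp_extMk hn _ _ (fun i => ModuleCat.ofHom (φ i)) ?_ ?_ _ _
    (resolutionComplex_d_comp_ofHom hP hfg)
  · have h0 : (resolution hq hP).π.f 0 = cochainHom hq 0 fun _ => 1 :=
      ChainComplex.toSingle₀Equiv_symm_apply_f_zero _ _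
    rw [h0]
    exact (ModuleCat.ofHom_comp _ _).symm.trans (congrArg ModuleCat.ofHom hφ0)
  · intro i
    change (resolutionComplex hq).d (n + i + 1) (n + i) ≫ _ = _ ≫ (resolutionComplex hq).d (i + 1) i
    rw [resolutionComplex_d, resolutionComplex_d]
    exact ((ModuleCat.ofHom_comp _ _).symm.trans (congrArg ModuleCat.ofHom (hφ i).symm)).trans
      (ModuleCat.ofHom_comp _ _)

/-- This is minimality of the resolution, and it keeps constants out of coboundaries. -/
theorem coef_mem_filE_one (ha : 3 ≤ a) (hq0 : q ≠ 0) (i j : ℕ) :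
    coefX k a q i j ∈ filE k a q 1 ∧ coefY k a q i j ∈ filE k a q 1 := by
  have hx := fun s => filE_mono (by omega : (1 : ℤ) ≤ a - 1)
    (gammaX_mem_filE (k := k) (a := a) hq0 s)
  have hy := fun s => filE_mono (by omega : (1 : ℤ) ≤ a - 1)
    (gammaY_mem_filE (k := k) (a := a) hq0 s)
  rw [coefX, coefY]
  constructor <;> split_ifs
  exacts [hx _, tauX_mem_filE hq0 _, hy _, neg_mem (hy _), tauY_mem_filE hq0 _,
    neg_mem (tauY_mem_filE hq0 _)]

/-- A coboundary has no constant terms. -/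
theorem apply_mem_filA_one (ha : 3 ≤ a) (h : Represents hP f 0) (i : Fin (n + 1)) :
    f (Finsupp.single i 1) ∈ filA k a q 1 := by
  have hq0 : q ≠ 0 := hq.ne_zero (by omega)
  obtain ⟨hf, h⟩ := h
  obtain _ | n := n
  · have h0 : f = 0 :=
      congrArg ModuleCat.Hom.hom (((resolution hq hP).extMk_zero_eq_zero_iff _ _).1 h)
    rw [h0]
    exact zero_mem _
  · obtain ⟨g, hg⟩ := ((resolution hq hP).extMk_eq_zero_iff _ _ _ _ n rfl).1 h
    have hg' : (resolutionComplex hq).d (n + 1) n ≫ g = ModuleCat.ofHom f := hg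
    rw [resolutionComplex_d] at hg'
    have h1 : g.hom ∘ₗ d k a q n = f := congrArg ModuleCat.Hom.hom hg'
    have h2 : ∀ (e : E k a q) (z : P k a q n), e ∈ filE k a q 1 →
        g.hom (e • z) ∈ filA k a q 1 := fun e z he => by
      have h3 : g.hom (e • z) = e • (g.hom z : QCI k a q) := g.hom.map_smul e z
      have h4 := smul_mem_filA (n := (g.hom z : QCI k a q)) (w := 0) he
        (by rw [filA_eq_top le_rfl]; trivial)
      rw [h3]
      exact h4
    rw [← h1]
    have hi := i.2
    change g.hom (d k a q n (Finsupp.single i 1)) ∈ _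
    rw [d_single, dgen_eq n i (by omega)]
    have h5 := h2 _ (gen k a q n i) (coef_mem_filE_one (k := k) ha hq0 i (n + 1 - i)).2
    have h6 := h2 _ (gen k a q n (i - 1)) (coef_mem_filE_one (k := k) ha hq0 i (n + 1 - i)).1
    have h7 := g.hom.map_add (coefY k a q i (n + 1 - i) • gen k a q n i)
      (coefX k a q i (n + 1 - i) • gen k a q n (i - 1))
    refine h7 ▸ add_mem h5 h6

end Represents

/-! ### The classes of degree at least `u` -/

variable (hP)

/-- The classes of degree at least `u`. -/
def filCoh (n : ℕ) (u : ℤ) : Submodule k (Coh k (QCI k a q) n) where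
  carrier := {z | ∃ f, Represents hP f z ∧
    ∀ i : Fin (n + 1), f (Finsupp.single i 1) ∈ filA k a q (wt a i + wt a (n - i) + u)}
  add_mem' := fun ⟨f, hf, hf'⟩ ⟨g, hg, hg'⟩ =>
    ⟨f + g, hf.add hg, fun i => add_mem (hf' i) (hg' i)⟩
  zero_mem' := ⟨0, .zero, fun _ => zero_mem _⟩
  smul_mem' r _ := fun ⟨f, hf, hf'⟩ => ⟨r • f, hf.smul r, fun i => Submodule.smul_mem _ r (hf' i)⟩

variable {hP}

/-- The product is `g ∘ φ m` for a lift `φ` raising degrees by `u`, and `g` raises them by `v`. -/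
theorem comp_mem_filCoh (ha : 3 ≤ a) {n m c : ℕ} {u v : ℤ} (hn : Even n) (h : n + m = c)
    {z : Coh k (QCI k a q) n} {w : Coh k (QCI k a q) m}
    (hz : z ∈ filCoh hP n u) (hw : w ∈ filCoh hP m v) : z.comp w h ∈ filCoh hP c (u + v) := by
  subst h
  obtain ⟨f, hf, hf'⟩ := hz
  obtain ⟨g, hg, hg'⟩ := hw
  obtain ⟨φ, hφ0, hφ, hu⟩ := exists_lift ha hq f hf.1 hf'
  refine ⟨_, hf.comp hg hn φ hφ0 hφ, fun i => ?_⟩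
  have := cochain_apply_mem_filA g hg'
    (hu m _ _ (single_one_mem_filP (k := k) (a := a) (hq.ne_zero (by omega)) i))
  rwa [add_assoc _ u v] at this

/-- The product with the class of a constant cocycle supported in one even place. -/
theorem comp_represents_shift {n m c j : ℕ} (hn : Even n) (hj : Even j)
    (hjn : j ≤ n) (h : n + m = c) {p : ℕ → QCI k a q}
    {z : Coh k (QCI k a q) n} {w : Coh k (QCI k a q) m}
    (hz : Represents hP (cochain k a q n (zetaVal k a q j)) z)
    (hw : Represents hP (cochain k a q m p) w) :
    Represents hP (cochain k a q c fun i => if j ≤ i ∧ i ≤ m + j then p (i - j) else 0)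
      (z.comp w h) := by
  subst h
  rw [← cochain_comp_shift (by omega)]
  -- The index shift by `j` is an explicit lift of the cocycle `ζ_j`.
  refine hz.comp hw hn (fun i => shift k a q j (n + i) i) ?_ fun i => ?_
  · rw [cochain_comp_shift (by omega)]
    congr 1
    funext i
    rw [zetaVal]
    exact if_congr (by omega) rfl rfl
  · exact d_comp_shift (show i + j ≤ n + i by omega) hj (by simp [Nat.even_add, hn])

end Represents
end HH
end

/-! ### Constant terms of classes and the filtration of the even ring. -/

noncomputable section

namespace HH

section Counit

variable (k : Type u) [Field k] {a : ℕ} (q : k)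

/-- The constant term. -/
def counit (ha : 3 ≤ a) : QCI k a q →ₐ[k] k :=
  RingQuot.liftAlgHom k ⟨FreeAlgebra.lift k fun _ => 0, by
    have h0 : (0 : k) ^ a = 0 := zero_pow (by omega)
    rintro _ _ (_ | _ | _) <;> simp [h0]⟩

variable {k q}

theorem counit_x (ha : 3 ≤ a) : counit k q ha (x k a q) = 0 := by
  refine (RingQuot.liftAlgHom_mkAlgHom_apply k _ _ _).trans ?_
  exact FreeAlgebra.lift_ι_apply _ _

theorem counit_y (ha : 3 ≤ a) : counit k q ha (y k a q) = 0 := by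
  refine (RingQuot.liftAlgHom_mkAlgHom_apply k _ _ _).trans ?_
  exact FreeAlgebra.lift_ι_apply _ _

theorem counit_eq_zero_iff (ha : 3 ≤ a) (m : QCI k a q) :
    counit k q ha m = 0 ↔ m ∈ filA k a q 1 := by
  have h1 : ∀ m ∈ filA k a q 1, counit k q ha m = 0 := fun m hm => by
    induction hm using Submodule.span_induction with
    | mem z hz =>
      obtain ⟨b, c, hbc, rfl⟩ := hz
      rw [mon, map_mul, map_pow, map_pow, counit_x, counit_y]
      obtain h | h : b ≠ 0 ∨ c ≠ 0 := by omega
      · rw [zero_pow h, zero_mul]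
      · rw [zero_pow h, mul_zero]
    | zero => exact map_zero _
    | add z w _ _ hz hw => rw [map_add, hz, hw, add_zero]
    | smul r z _ hz => rw [map_smul, hz, smul_zero]
  refine ⟨fun h => ?_, h1 m⟩
  have h2 : ∀ m : QCI k a q, m - counit k q ha m • 1 ∈ filA k a q 1 := fun m => by
    have hm : m ∈ Submodule.span k (Set.range fun p : ℕ × ℕ => mon k a q p.1 p.2) := by
      rw [span_mon]
      trivial
    induction hm using Submodule.span_induction with
    | mem z hz =>
      obtain ⟨⟨b, c⟩, rfl⟩ := hz
      change mon k a q b c - counit k q ha (mon k a q b c) • 1 ∈ _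
      by_cases h : 1 ≤ b + c
      · have h3 : mon k a q b c ∈ filA k a q 1 := mon_mem_filA (by exact_mod_cast h)
        rwa [h1 _ h3, zero_smul, sub_zero]
      · obtain ⟨rfl, rfl⟩ : b = 0 ∧ c = 0 := by omega
        rw [← one_eq_mon, map_one, one_smul, sub_self]
        exact zero_mem _
    | zero => simp
    | add z w _ _ hz hw =>
      rw [map_add, add_smul, add_sub_add_comm]
      exact add_mem hz hw
    | smul r z _ hz =>
      rw [map_smul, smul_assoc, ← smul_sub]
      exact Submodule.smul_mem _ r hz
  have h3 := h2 m
  rwa [h, zero_smul, sub_zero] at h3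

end Counit

section LeadingCoeff

variable {k : Type u} [Field k] {a : ℕ} {q : k} (ha : 3 ≤ a) {hq : IsPrimitiveRoot q a}
  (hP : QuasiIso (augmentation hq))

/-- Two representatives differ by a coboundary, which has no constant terms. Hence `constCoeff` does
not depend on the chosen cocycle. -/
theorem Represents.counit_congr {n : ℕ} {f g : P k a q n →ₗ[E k a q] QCI k a q}
    {z : Coh k (QCI k a q) n} (hf : Represents hP f z) (hg : Represents hP g z)
    (i : Fin (n + 1)) :
    counit k q ha (f (Finsupp.single i 1)) = counit k q ha (g (Finsupp.single i 1)) := by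
  have h := hf.sub hg
  rw [sub_self] at h
  rw [← sub_eq_zero, ← map_sub, counit_eq_zero_iff]
  exact h.apply_mem_filA_one ha i

/-- The constant term of the value of a class at a generator. -/
def constCoeff (n : ℕ) (i : Fin (n + 1)) : Coh k (QCI k a q) n →ₗ[k] k where
  toFun z := counit k q ha ((exists_represents (hP := hP) z).choose (Finsupp.single i 1))
  map_add' z w := by
    rw [Represents.counit_congr ha hP (exists_represents (hP := hP) (z + w)).choose_spec
      ((exists_represents (hP := hP) z).choose_spec.add
        (exists_represents (hP := hP) w).choose_spec), LinearMap.add_apply, map_add]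
  map_smul' r z := by
    rw [Represents.counit_congr ha hP (exists_represents (hP := hP) (r • z)).choose_spec
      ((exists_represents (hP := hP) z).choose_spec.smul r), LinearMap.smul_apply, map_smul]
    rfl

theorem Represents.constCoeff_eq {n : ℕ} {f : P k a q n →ₗ[E k a q] QCI k a q}
    {z : Coh k (QCI k a q) n} (hf : Represents hP f z) (i : Fin (n + 1)) :
    constCoeff ha hP n i z = counit k q ha (f (Finsupp.single i 1)) :=
  Represents.counit_congr ha hP (exists_represents z).choose_spec hf i

theorem cochain_single {n : ℕ} (p : ℕ → QCI k a q) (i : Fin (n + 1)) :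
    cochain k a q n p (Finsupp.single i 1) = p i := by
  rw [cochain, Finsupp.linearCombination_single, one_smul]

theorem wt_add_wt_of_even {t i : ℕ} (hi : i ≤ 2 * t) (h : Even i) :
    wt a i + wt a (2 * t - i) = a * t := by
  obtain ⟨j, rfl⟩ := h
  rw [wt, wt, show (j + j) / 2 = j by omega, show (j + j) % 2 = 0 by omega,
    show (2 * t - (j + j)) / 2 = t - j by omega, show (2 * t - (j + j)) % 2 = 0 by omega,
    Nat.cast_sub (by omega)]
  push_cast
  ring

/-- Generators in odd places have degree smaller by `a - 2` than those in even places; this gap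
pushes the odd `ζ` into positive degree. -/
theorem wt_add_wt_of_odd {t i : ℕ} (hi : i ≤ 2 * t) (h : ¬ Even i) :
    wt a i + wt a (2 * t - i) = a * t - a + 2 := by
  obtain ⟨j, rfl⟩ := Nat.not_even_iff_odd.1 h
  rw [wt, wt, show (2 * j + 1) / 2 = j by omega, show (2 * j + 1) % 2 = 1 by omega,
    show (2 * t - (2 * j + 1)) / 2 = t - j - 1 by omega,
    show (2 * t - (2 * j + 1)) % 2 = 1 by omega, Nat.cast_sub (by omega), Nat.cast_sub (by omega)]
  push_cast
  ring

end LeadingCoeff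

/-! ### The filtration of the ring -/

section FilRing

variable {k : Type u} [Field k] {a : ℕ} {q : k} {hq : IsPrimitiveRoot q a}
  (hP : QuasiIso (augmentation hq))

/-- The elements of degree at least `w`, where the component of index `t` is shifted so that the
classes `ζ_i^{2t}` with `i` even have degree zero. -/
def filRing (w : ℤ) : Submodule k (EvenRing k (QCI k a q)) where
  carrier := {z | ∀ t : ℕ, z t ∈ filCoh hP (2 * t) (w - a * t)}
  add_mem' hz hw t := add_mem (hz t) (hw t)
  zero_mem' _ := zero_mem _
  smul_mem' r _ hz t := Submodule.smul_mem _ r (hz t)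

variable {hP}

theorem of_mem_filRing {w : ℤ} {t : ℕ} {z : EvenCoh k (QCI k a q) t}
    (hz : z ∈ filCoh hP (2 * t) (w - a * t)) :
    DirectSum.of (EvenCoh k (QCI k a q)) t z ∈ filRing hP w := by
  intro s
  by_cases h : t = s
  · subst h
    rwa [DirectSum.of_eq_same]
  · rw [DirectSum.of_eq_of_ne _ _ _ (Ne.symm h)]
    exact zero_mem _

theorem mul_mem_filRing (ha : 3 ≤ a) {v w : ℤ} {z z' : EvenRing k (QCI k a q)} (hz : z ∈ filRing hP v)
    (hz' : z' ∈ filRing hP w) : z * z' ∈ filRing hP (v + w) := by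
  classical
  rw [← DirectSum.sum_support_of z, ← DirectSum.sum_support_of z', Finset.sum_mul_sum]
  refine sum_mem fun i _ => sum_mem fun j _ => ?_
  rw [DirectSum.of_mul_of]
  refine of_mem_filRing ?_
  have := comp_mem_filCoh ha (even_two_mul i) (by ring : 2 * i + 2 * j = 2 * (i + j)) (hz i) (hz' j)
  rw [show v - a * i + (w - a * j) = v + w - a * (i + j : ℕ) by push_cast; ring] at this
  exact this

theorem mem_filRing_zero (ha : 3 ≤ a) (z : EvenRing k (QCI k a q)) : z ∈ filRing hP 0 := by
  intro t
  obtain ⟨f, hf⟩ := exists_represents (hP := hP) (z t)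
  refine ⟨f, hf, fun i => ?_⟩
  rw [filA_eq_top]
  · trivial
  · have hi := Nat.lt_succ_iff.1 i.2
    by_cases h : Even (i : ℕ)
    · rw [wt_add_wt_of_even hi h]; linarith
    · rw [wt_add_wt_of_odd hi h]
      have : (3 : ℤ) ≤ a := by exact_mod_cast ha
      linarith

/-- At an odd place the value would have degree at least `w - (a - 2) ≥ 2a - 1`, beyond the top
degree of `A`; at an even place the bound is `w` itself. -/
theorem filRing_eq_zero (ha : 3 ≤ a) {z : EvenRing k (QCI k a q)} {w : ℤ} (hw : 3 * a - 3 ≤ w)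
    (hz : z ∈ filRing hP w) : z = 0 := by
  refine DFinsupp.ext fun t => ?_
  obtain ⟨f, hf, hf'⟩ := hz t
  have : f = 0 := by
    refine Finsupp.lhom_ext' fun i => LinearMap.ext_ring ?_
    have h := hf' i
    rw [filA_eq_bot] at h
    · exact h
    · have hi := Nat.lt_succ_iff.1 i.2
      have : (3 : ℤ) ≤ a := by exact_mod_cast ha
      by_cases h : Even (i : ℕ)
      · rw [wt_add_wt_of_even hi h]; linarith
      · rw [wt_add_wt_of_odd hi h]; linarith
  exact (this ▸ hf).eq_zero

/-- At an even place the condition says that the value has no constant term. At an odd place it asks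
for degree at least `3 - a ≤ 0`, which is no condition. -/
theorem mem_filRing_one_iff (ha : 3 ≤ a) {z : EvenRing k (QCI k a q)} : z ∈ filRing hP 1 ↔
    ∀ (t : ℕ) (i : Fin (2 * t + 1)), Even (i : ℕ) → constCoeff ha hP (2 * t) i (z t) = 0 := by
  have ha' : (3 : ℤ) ≤ a := by exact_mod_cast ha
  refine forall_congr' fun t => ⟨fun ⟨f, hf, hf'⟩ i hi => ?_, fun h => ?_⟩
  · rw [hf.constCoeff_eq, counit_eq_zero_iff]
    have := hf' i
    rwa [wt_add_wt_of_even (Nat.lt_succ_iff.1 i.2) hi, add_sub_cancel] at this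
  · obtain ⟨f, hf⟩ := exists_represents (hP := hP) (z t)
    refine ⟨f, hf, fun i => ?_⟩
    by_cases hi : Even (i : ℕ)
    · have := h i hi
      rw [hf.constCoeff_eq, counit_eq_zero_iff] at this
      rwa [wt_add_wt_of_even (Nat.lt_succ_iff.1 i.2) hi, add_sub_cancel]
    · rw [wt_add_wt_of_odd (Nat.lt_succ_iff.1 i.2) hi, filA_eq_top (by linarith)]
      trivial

end FilRing
end HH
end

/-! ### The polynomial subring and the nilpotent ideal. -/

noncomputable section

namespace HH

section Ring

variable {k : Type u} [Field k] {a : ℕ} {q : k} (ha : 3 ≤ a) {hq : IsPrimitiveRoot q a}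
  (hP : QuasiIso (augmentation hq))

/-- The class `ζ_j^{2t}` in `HH^{2t}(A)`. -/
def zetaCoh (t j : ℕ) : EvenCoh k (QCI k a q) t :=
  (resolution hq hP).extMk (cochainHom hq (2 * t) (zetaVal k a q j)) (2 * t + 1) rfl
    (d_comp_cochainHom hq _ _ (zeta_cocycle ha hq t j))

theorem zeta_eq_of (t j : ℕ) :
    zeta ha hq hP t j = DirectSum.of (EvenCoh k (QCI k a q)) t (zetaCoh ha hP t j) := rfl

theorem represents_zetaCoh (t j : ℕ) :
    Represents hP (cochain k a q (2 * t) (zetaVal k a q j)) (zetaCoh ha hP t j) :=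
  ⟨zeta_cocycle ha hq t j, rfl⟩

theorem zeta_mul_zeta {s t i j : ℕ} (hi : i ≤ 2 * s) (hi' : Even i) (hj : j ≤ 2 * t) :
    zeta ha hq hP s i * zeta ha hq hP t j = zeta ha hq hP (s + t) (i + j) := by
  rw [zeta_eq_of, zeta_eq_of, zeta_eq_of, DirectSum.of_mul_of]
  congr 1
  refine (comp_represents_shift (even_two_mul s) hi' hi
    (by ring : 2 * s + 2 * t = 2 * (s + t)) (represents_zetaCoh ha hP s i)
    (represents_zetaCoh ha hP t j)).unique ((represents_zetaCoh ha hP _ _).congr_left ?_)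
  congr 1
  funext l
  rw [zetaVal, zetaVal]
  split_ifs <;> first | rfl | omega

theorem eq_cochain {n : ℕ} {f : P k a q n →ₗ[E k a q] QCI k a q} {p : ℕ → QCI k a q}
    (h : ∀ i : Fin (n + 1), f (Finsupp.single i 1) = p i) : f = cochain k a q n p :=
  Finsupp.lhom_ext' fun i => LinearMap.ext_ring ((h i).trans (cochain_single p i).symm)

/-- The product `ζ_0 · 1` equals `ζ_0`, while multiplication by `ζ_0` is the shift by zero and
returns the cocycle of `1`. No explicit cocycle for the identity is needed. -/
theorem zeta_zero_zero : zeta ha hq hP 0 0 = 1 := by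
  have h : (zetaCoh ha hP 0 0) = Abelian.Ext.mk₀ (𝟙 (bimod k (QCI k a q))) := by
    obtain ⟨f, hf⟩ := exists_represents (hP := hP)
      (Abelian.Ext.mk₀ (𝟙 (bimod k (QCI k a q))))
    have hf' : f = cochain k a q 0 fun _ => f (Finsupp.single 0 1) :=
      eq_cochain fun i => by rw [Fin.fin_one_eq_zero i]
    rw [hf'] at hf
    have h1 := comp_represents_shift (c := 0) Even.zero Even.zero le_rfl rfl
      (represents_zetaCoh ha hP 0 0) hf
    refine (Abelian.Ext.comp_mk₀_id _).symm.trans (h1.unique (hf.congr_left ?_))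
    refine eq_cochain fun i => ?_
    rw [cochain_single, Fin.fin_one_eq_zero i]
    simp
  rw [zeta_eq_of, h]
  rfl

theorem constCoeff_zeta (s t j : ℕ) (i : Fin (2 * s + 1)) :
    constCoeff ha hP (2 * s) i (zeta ha hq hP t j s) = if t = s ∧ (i : ℕ) = j then 1 else 0 := by
  by_cases h : t = s
  · subst h
    rw [zeta_eq_of, DirectSum.of_eq_same, (represents_zetaCoh ha hP t j).constCoeff_eq,
      cochain_single, zetaVal]
    split_ifs <;> simp_all
  · rw [zeta_eq_of, DirectSum.of_eq_of_ne _ _ _ (Ne.symm h), map_zero, if_neg (by tauto)]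

/-- The homomorphism `z_0 ↦ ζ_0^2`, `z_1 ↦ ζ_2^2`. -/
def polyHom : MvPolynomial (Fin 2) k →ₐ[k] EvenRing k (QCI k a q) :=
  AddMonoidAlgebra.lift k (EvenRing k (QCI k a q)) (Fin 2 →₀ ℕ)
    { toFun := fun m => zeta ha hq hP (m.toAdd 0 + m.toAdd 1) (2 * m.toAdd 1)
      map_one' := zeta_zero_zero ha hP
      map_mul' := fun m n => by
        rw [zeta_mul_zeta ha hP (by omega) (even_two_mul _) (by omega), toAdd_mul,
          Finsupp.add_apply, Finsupp.add_apply]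
        congr 1 <;> ring }

theorem polyHom_monomial (m : Fin 2 →₀ ℕ) (r : k) :
    polyHom ha hP (MvPolynomial.monomial m r) = r • zeta ha hq hP (m 0 + m 1) (2 * m 1) :=
  AddMonoidAlgebra.lift_single _ _ _

theorem range_polyHom :
    Subalgebra.toSubmodule (polyHom ha hP).range = R0 ha hq hP := by
  refine le_antisymm ?_ (Submodule.span_le.2 ?_)
  · rintro _ ⟨p, rfl⟩
    change polyHom ha hP p ∈ _
    induction p using MvPolynomial.induction_on' with
    | monomial m r =>
      rw [polyHom_monomial]
      exact Submodule.smul_mem _ _ (Submodule.subset_span ⟨_, _, by omega, even_two_mul _, rfl⟩)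
    | add p p' hp hp' =>
      rw [map_add]
      exact add_mem hp hp'
  · rintro _ ⟨t, i, hi, ⟨j, rfl⟩, rfl⟩
    -- The class `ζ^{2t}_{2j}` is the image of `z_0^{t-j} z_1^j`.
    refine ⟨MvPolynomial.monomial (Finsupp.single 0 (t - j) + Finsupp.single 1 j) 1, ?_⟩
    change polyHom ha hP _ = _
    rw [polyHom_monomial, one_smul]
    congr 1
    · simp
      omega
    · simp [two_mul]

/-- Distinct monomials go to distinct pairs of cohomological degree and even place, so constant
terms recover all coefficients. Injectivity modulo `filRing hP 1` follows. -/
theorem constCoeff_polyHom (p : MvPolynomial (Fin 2) k) (m : Fin 2 →₀ ℕ) :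
    constCoeff ha hP (2 * (m 0 + m 1)) ⟨2 * m 1, by omega⟩ (polyHom ha hP p (m 0 + m 1)) =
      p.coeff m := by
  induction p using MvPolynomial.induction_on' with
  | monomial n r =>
    have h : n = m ↔ n 0 + n 1 = m 0 + m 1 ∧ 2 * m 1 = 2 * n 1 := by
      rw [Finsupp.ext_iff, Fin.forall_fin_two]
      omega
    rw [polyHom_monomial, MvPolynomial.coeff_monomial, DirectSum.smul_apply, map_smul,
      constCoeff_zeta, if_congr h rfl rfl]
    simp
  | add p p' hp hp' => rw [map_add, DirectSum.add_apply, map_add, hp, hp', MvPolynomial.coeff_add]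

theorem eq_zero_of_polyHom_mem {p : MvPolynomial (Fin 2) k}
    (h : polyHom ha hP p ∈ filRing hP 1) : p = 0 := by
  ext m
  rw [← constCoeff_polyHom ha hP, (mem_filRing_one_iff ha).1 h _ _ (even_two_mul _),
    MvPolynomial.coeff_zero]

theorem exists_sub_polyHom_mem (z : EvenRing k (QCI k a q)) :
    ∃ p, z - polyHom ha hP p ∈ filRing hP 1 := by
  induction z using DirectSum.induction_on with
  | zero => exact ⟨0, by simp⟩
  | add z w hz hw =>
    obtain ⟨p, hp⟩ := hz
    obtain ⟨p', hp'⟩ := hw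
    refine ⟨p + p', ?_⟩
    rw [map_add, add_sub_add_comm]
    exact add_mem hp hp'
  | of t z =>
    -- The element of `R_0` to subtract is the one with the same constant terms at the even places.
    obtain ⟨p, hp⟩ : ∑ i ∈ Finset.univ.filter fun i : Fin (2 * t + 1) => Even (i : ℕ),
        constCoeff ha hP (2 * t) i z • zeta ha hq hP t i ∈
        Subalgebra.toSubmodule (polyHom ha hP).range := by
      rw [range_polyHom]
      refine sum_mem fun i hi => Submodule.smul_mem _ _ (Submodule.subset_span
        ⟨_, _, Nat.lt_succ_iff.1 i.2, (Finset.mem_filter.1 hi).2, rfl⟩)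
    refine ⟨p, (mem_filRing_one_iff ha).2 fun s i hi => ?_⟩
    change polyHom ha hP p = _ at hp
    rw [hp, DirectSum.sub_apply, map_sub, DirectSum.sum_apply, map_sum]
    simp only [DirectSum.smul_apply, map_smul, constCoeff_zeta]
    by_cases h : t = s
    · subst h
      simp [DirectSum.of_eq_same, Fin.val_inj, Finset.sum_ite_eq, hi]
    · rw [DirectSum.of_eq_of_ne _ _ _ (Ne.symm h)]
      simp [h]

/-! ### The nilpotent ideal -/

/-- The elements of degree at least `w` form an ideal. -/
def filIdeal (w : ℤ) : Ideal (EvenRing k (QCI k a q)) where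
  __ := filRing hP w
  smul_mem' z w hw := by
    have := mul_mem_filRing ha (mem_filRing_zero ha z) hw
    rwa [zero_add] at this

instance isTwoSided_filIdeal (w : ℤ) : (filIdeal ha hP w).IsTwoSided where
  mul_mem_of_left z hw := by
    have := mul_mem_filRing ha hw (mem_filRing_zero ha z)
    rwa [add_zero] at this

theorem isHomogeneous_filIdeal (w : ℤ) : IsHomogeneousIdeal (filIdeal ha hP w) :=
  fun _ hz t => of_mem_filRing (hz t)

theorem filIdeal_pow_le (n : ℕ) : filIdeal ha hP 1 ^ n ≤ filIdeal ha hP n := by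
  induction n with
  | zero => exact fun z _ => mem_filRing_zero ha z
  | succ n ih =>
    rw [Submodule.pow_succ, Ideal.mul_le]
    intro z hz w hw
    have := mul_mem_filRing ha (ih hz) hw
    exact_mod_cast this

theorem isNilpotent_filIdeal : IsNilpotent (filIdeal ha hP 1) := by
  -- Any exponent from `3a - 3` on would do.
  refine ⟨3 * a, eq_bot_iff.2 fun z hz => ?_⟩
  exact filRing_eq_zero ha (by push_cast; linarith) (filIdeal_pow_le ha hP (3 * a) hz)

theorem isNilpotent_of_mem {I : Ideal (EvenRing k (QCI k a q))} (hI : IsNilpotent I)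
    {z : EvenRing k (QCI k a q)} (hz : z ∈ I) : IsNilpotent z := by
  obtain ⟨n, hn⟩ := hI
  have := Ideal.pow_mem_pow hz n
  rw [hn] at this
  exact ⟨n, this⟩

variable {hP} in
theorem of_mem_filRing_one (ha : 3 ≤ a) {t : ℕ} {f : P k a q (2 * t) →ₗ[E k a q] QCI k a q}
    {z : EvenCoh k (QCI k a q) t} (hf : Represents hP f z)
    (h : ∀ i : Fin (2 * t + 1), Even (i : ℕ) → f (Finsupp.single i 1) ∈ filA k a q 1) :
    DirectSum.of (EvenCoh k (QCI k a q)) t z ∈ filRing hP 1 := by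
  refine (mem_filRing_one_iff ha).2 fun s i hi => ?_
  by_cases hs : t = s
  · subst hs
    rw [DirectSum.of_eq_same, hf.constCoeff_eq, counit_eq_zero_iff]
    exact h i hi
  · rw [DirectSum.of_eq_of_ne _ _ _ (Ne.symm hs), map_zero]

theorem etaPlus_mem_filIdeal (t : ℕ) {j : ℕ} (hj : Even j) :
    etaPlus ha hq hP t hj ∈ filIdeal ha hP 1 := by
  refine of_mem_filRing_one ha (f := cochain k a q (2 * t) (etaPlusVal k a q j))
    ⟨etaPlus_cocycle ha hq t hj, rfl⟩ fun i _ => ?_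
  rw [cochain_single, etaPlusVal]
  split_ifs
  · rw [← counit_eq_zero_iff ha, map_mul, map_pow, counit_x, zero_pow (by omega), zero_mul]
  · exact zero_mem _

theorem etaMinus_mem_filIdeal (t : ℕ) {j : ℕ} (hj : ¬ Even j) :
    etaMinus hq hP t hj ∈ filIdeal ha hP 1 := by
  refine of_mem_filRing_one ha (f := cochain k a q (2 * t) (etaMinusVal k a q j))
    ⟨etaMinus_cocycle t hj, rfl⟩ fun i hi => ?_
  rw [cochain_single, etaMinusVal, if_neg fun h : (i : ℕ) = j => hj (h ▸ hi)]
  exact zero_mem _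

theorem mem_filIdeal_of_mem_R1 {z : EvenRing k (QCI k a q)} (hz : z ∈ R1 ha hq hP) :
    z ∈ filIdeal ha hP 1 := by
  refine (Submodule.span_le (p := filRing hP 1)).2 ?_ hz
  rintro _ ⟨t, j, _, hj, rfl⟩
  refine of_mem_filRing_one ha (represents_zetaCoh ha hP t j) fun i hi => ?_
  rw [cochain_single, zetaVal, if_neg fun h : (i : ℕ) = j => hj (h ▸ hi)]
  exact zero_mem _

/-- The quotient by the nilpotent ideal is the polynomial subalgebra. -/
theorem bijective_mk_comp_val : Function.Bijective
    ((Ideal.Quotient.mkₐ k (filIdeal ha hP 1)).comp (polyHom ha hP).range.val) := by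
  constructor
  · refine (injective_iff_map_eq_zero _).2 ?_
    rintro ⟨_, p, rfl⟩ h
    have h' := eq_zero_of_polyHom_mem ha hP (Ideal.Quotient.eq_zero_iff_mem.1 h)
    subst h'
    exact Subtype.ext (map_zero _)
  · intro z
    obtain ⟨z, rfl⟩ := Ideal.Quotient.mk_surjective z
    obtain ⟨p, hp⟩ := exists_sub_polyHom_mem ha hP z
    exact ⟨⟨polyHom ha hP p, p, rfl⟩, (Ideal.Quotient.eq.2 hp).symm⟩

theorem injective_polyHom : Function.Injective (polyHom ha hP) :=
  (injective_iff_map_eq_zero _).2 fun p hp => eq_zero_of_polyHom_mem ha hP (by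
    rw [hp]
    exact zero_mem _)

/-- An element of `I` is congruent to some polynomial `p` modulo `filRing hP 1`. Nilpotency puts a
power of `p` into `filRing hP 1`, hence that power is zero, and so is `p`, the polynomial ring being
reduced. -/
theorem le_filIdeal_of_isNilpotent {I : Ideal (EvenRing k (QCI k a q))} (hI : IsNilpotent I) :
    I ≤ filIdeal ha hP 1 := by
  intro z hz
  obtain ⟨p, hp⟩ := exists_sub_polyHom_mem ha hP z
  have hp' : Ideal.Quotient.mk (filIdeal ha hP 1) z =
      Ideal.Quotient.mk (filIdeal ha hP 1) (polyHom ha hP p) := Ideal.Quotient.eq.2 hp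
  obtain ⟨n, hn⟩ := isNilpotent_of_mem hI hz
  have h : polyHom ha hP (p ^ n) ∈ filRing hP 1 := by
    refine (Ideal.Quotient.eq_zero_iff_mem (I := filIdeal ha hP 1)).1 ?_
    rw [map_pow, map_pow, ← hp', ← map_pow, hn, map_zero]
  have h0 := eq_zero_of_pow_eq_zero (eq_zero_of_polyHom_mem ha hP h)
  rw [h0, map_zero, map_zero] at hp'
  exact Ideal.Quotient.eq_zero_iff_mem.1 hp'

end Ring
end HH
end

theorem mainTheorem4 {k : Type u} [Field k] {a : ℕ} (ha : 3 ≤ a) {q : k}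
    (hq : IsPrimitiveRoot q a) :
    ∃ hP : QuasiIso (HH.augmentation hq),
      ∃ R₀ : Subalgebra k (HH.EvenRing k (HH.QCI k a q)),
        Subalgebra.toSubmodule R₀ = HH.R0 ha hq hP ∧
        (∃ e : MvPolynomial (Fin 2) k ≃ₐ[k] R₀,
          (e (MvPolynomial.X 0) : HH.EvenRing k (HH.QCI k a q)) = HH.zeta ha hq hP 1 0 ∧
          (e (MvPolynomial.X 1) : HH.EvenRing k (HH.QCI k a q)) = HH.zeta ha hq hP 1 2) ∧
        ∃ (N : Ideal (HH.EvenRing k (HH.QCI k a q))) (_ : N.IsTwoSided),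
          IsGreatest {I : Ideal (HH.EvenRing k (HH.QCI k a q)) |
            I.IsTwoSided ∧ HH.IsHomogeneousIdeal I ∧ IsNilpotent I} N ∧
          (∀ (t j : ℕ) (hj : Even j), j ≤ 2 * t →
            HH.etaPlus ha hq hP t hj ∈ N ∧ IsNilpotent (HH.etaPlus ha hq hP t hj)) ∧
          (∀ (t j : ℕ) (hj : ¬ Even j), j ≤ 2 * t →
            HH.etaMinus hq hP t hj ∈ N ∧ IsNilpotent (HH.etaMinus hq hP t hj)) ∧
          (∀ z ∈ HH.R1 ha hq hP, z ∈ N ∧ IsNilpotent z) ∧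
          (∀ z ∈ R₀, z ∈ N → z = 0) ∧
          ∃ φ : (HH.EvenRing k (HH.QCI k a q) ⧸ N) ≃ₐ[k] R₀,
            ∀ z : R₀, φ (Ideal.Quotient.mk N z) = z := by
  have hP := HH.quasiIso_augmentation ha hq
  have hN := HH.isNilpotent_filIdeal ha hP
  refine ⟨hP, (HH.polyHom ha hP).range, HH.range_polyHom ha hP,
    ⟨AlgEquiv.ofInjective _ (HH.injective_polyHom ha hP), ?_, ?_⟩,
    HH.filIdeal ha hP 1, HH.isTwoSided_filIdeal ha hP 1,
    ⟨⟨HH.isTwoSided_filIdeal ha hP 1, HH.isHomogeneous_filIdeal ha hP 1, hN⟩,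
      fun I hI => HH.le_filIdeal_of_isNilpotent ha hP hI.2.2⟩,
    fun t j hj _ => ?_, fun t j hj _ => ?_, fun z hz => ?_, ?_,
    (AlgEquiv.ofBijective _ (HH.bijective_mk_comp_val ha hP)).symm, fun z => ?_⟩
  · refine (HH.polyHom_monomial ha hP _ 1).trans ?_
    simp
  · refine (HH.polyHom_monomial ha hP _ 1).trans ?_
    simp
  · have h := HH.etaPlus_mem_filIdeal ha hP t hj
    exact ⟨h, HH.isNilpotent_of_mem hN h⟩
  · have h := HH.etaMinus_mem_filIdeal ha hP t hj
    exact ⟨h, HH.isNilpotent_of_mem hN h⟩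
  · have h := HH.mem_filIdeal_of_mem_R1 ha hP hz
    exact ⟨h, HH.isNilpotent_of_mem hN h⟩
  · rintro _ ⟨p, rfl⟩ h
    have h' := HH.eq_zero_of_polyHom_mem ha hP h
    subst h'
    exact map_zero _
  · exact (AlgEquiv.ofBijective _ (HH.bijective_mk_comp_val ha hP)).symm_apply_apply z
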